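/- Let $X$ be a set and call any function $h\colon X\to\{0,1\}$ a hypothesis. For a (discrete) distribution $D$ on $X\times\{0,1\}$ put $\mathrm{err}_D(h)=\Pr_{(x,y)\sim D}[h(x)\ne y]$; $D$ is labeled by $h$ if $y=h(x)$ for all $(x,y)$ in its support. For a class $H$ of hypotheses, $\mathrm{RepDim}(H)$ is the least $\ln k$, over integers $k\ge 1$, such that there is a distribution $P$ over hypothesis classes $V$ with at most $k$ members satisfying $$\Pr_{V\sim P}\bigl[\exists v\in V:\ \mathrm{err}_D(v)\le 1/4\bigr]\ \ge\ 3/4$$ for every $h^\star\in H$ and every distribution $D$ labeled by $h^\star$ ($\mathrm{RepDim}(H)=\infty$ if there is no such $k$). Such a $P$ is the law of $\{v_1,\dots,v_k\}$ for a random $k$-tuple of hypotheses, where the space $\{0,1\}^X$ of hypotheses carries the product $\sigma$-algebra. A randomized online learner for $T$ rounds outputs in round $t$ a hypothesis $h_t$ (not necessarily in $H$) that depends on the examples $(x_1,y_1),\dots,(x_{t-1},y_{t-1})\in X\times\{0,1\}$ and on its internal randomness. It is $\varepsilon$-differentially private if for all streams $S_1,S_2\in(X\times\{0,1\})^T$ that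 differ in only one entry and every measurable set $O$ of output sequences, $\Pr[(h_1,\dots,h_T)\in O \text{ on } S_1]\le e^{\varepsilon}\,\Pr[(h_1,\dots,h_T)\in O \text{ on } S_2]$. **Theorem.** There is an absolute constant $C>0$ such that for every set $X$, every nonempty class $H\subseteq\{0,1\}^X$ with $\mathrm{RepDim}(H)<\infty$, every $\varepsilon>0$ and every integer $T\ge 3$ there is an $\varepsilon$-differentially private online learner for $T$ rounds whose expected regret against every oblivious adversary, that is, on every fixed stream $S=((x_1,y_1),\dots,(x_T,y_T))$ (agnostic setting: no assumption on $S$), satisfies $$\mathbb E\Bigl[\sum_{t=1}^T \mathbf 1[h_t(x_t)\ne y_t]-\min_{h\in H}\sum_{t=1}^T\mathbf 1[h(x_t)\ne y_t]\Bigr]\ \le\ C\cdot\frac{\sqrt T\,\log T\,\bigl(\mathrm{RepDim}(H)+\log\log T\bigr)}{\min(\varepsilon,1)} .$$ In particular, for $0<\varepsilon\le 1$ the expected regret is $O\bigl(\sqrt T\log T(\mathrm{RepDim}(H)+\log\log T)/\varepsilon\bigr)$ with an absolute constant. -/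

import Mathlib

open MeasureTheory
open scoped ENNReal

universe u

/-- A hypothesis on the domain `X`: a `{0,1}`-valued function, with no restriction. The space of
hypotheses carries the product `σ`-algebra, generated by the evaluations `h ↦ h x`. -/
abbrev Hypothesis (X : Type u) : Type u := X → Bool

/-! ### Representation dimension -/

/-- `err_D(h) = Pr_{(x,y) ∼ D}[h(x) ≠ y]`. The domain `X` is a bare set, every subset of
`X × {0,1}` is an event, and `D` is a probability mass function. -/
noncomputable def err {X : Type u} (D : PMF (X × Bool)) (h : Hypothesis X) : ℝ≥0∞ :=
  D.toOuterMeasure {p | h p.1 ≠ p.2}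

/-- `D` is labeled by `h`: `y = h(x)` for every `(x,y)` that `D` can produce. -/
def LabeledBy {X : Type u} (D : PMF (X × Bool)) (h : Hypothesis X) : Prop :=
  ∀ p ∈ D.support, p.2 = h p.1

/-- A distribution over hypothesis classes with at most `k` members is the law `P` of a random
class `V = {v 0, …, v (k - 1)}`; repetitions among the `v i` are allowed. It is an
`(α, β)`-probabilistic representation for `H` if for every `h ∈ H` and every `D` labeled by `h`
the random class contains, with probability at least `1 - β`, a hypothesis of error at most `α`. -/
def IsProbRep {X : Type u} (α β : ℝ≥0∞) (H : Set (Hypothesis X)) {k : ℕ}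
    (P : Measure (Fin k → Hypothesis X)) : Prop :=
  ∀ h ∈ H, ∀ D : PMF (X × Bool), LabeledBy D h →
    1 - β ≤ P {v | ∃ i, err D (v i) ≤ α}

/-- The representation dimension: the least `ln k` for which there is a
`(1/4, 1/4)`-probabilistic representation by random classes with at most `k` members
(`∞` if there is none). -/
noncomputable def repDim {X : Type u} (H : Set (Hypothesis X)) : ℝ≥0∞ :=
  ⨅ (k : ℕ) (_ : 1 ≤ k ∧ ∃ P : Measure (Fin k → Hypothesis X),
      IsProbabilityMeasure P ∧ IsProbRep (1 / 4) (1 / 4) H P),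
    ENNReal.ofReal (Real.log k)

/-! ### Online learning against oblivious adversaries -/

/-- A data stream of length `T`. -/
abbrev DataStream (X : Type u) (T : ℕ) : Type u := Fin T → X × Bool

/-- A randomized online learning algorithm for `T` rounds. It draws its internal randomness
`ω : Seed` from `law`; in round `t` it outputs the hypothesis `predict t past ω`, where `past`
consists of the examples of the rounds before `t`. -/
structure OnlineLearner (X : Type u) (T : ℕ) where
  Seed : Type u
  seedSpace : MeasurableSpace Seed
  law : Measure Seed
  law_prob : IsProbabilityMeasure law
  predict : (t : Fin T) → (Fin t.val → X × Bool) → Seed → Hypothesis X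
  measurable_predict : ∀ t past, Measurable (predict t past)

namespace OnlineLearner

variable {X : Type u} {T : ℕ}

instance (A : OnlineLearner X T) : MeasurableSpace A.Seed := A.seedSpace

instance (A : OnlineLearner X T) : IsProbabilityMeasure A.law := A.law_prob

/-- The sequence `(h_1, …, h_T)` of hypotheses that `A` outputs on the stream `S`. -/
def outputs (A : OnlineLearner X T) (S : DataStream X T) (ω : A.Seed) : Fin T → Hypothesis X :=
  fun t => A.predict t (fun i => S ⟨i.val, i.isLt.trans t.isLt⟩) ω

/-- `A` is `ε`-differentially private: `Pr[A(S₁) ∈ O] ≤ e^ε Pr[A(S₂) ∈ O]` for all streams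
`S₁`, `S₂` that differ in only one entry and every event `O` about the whole output sequence. -/
def IsDP (A : OnlineLearner X T) (ε : ℝ) : Prop :=
  ∀ S₁ S₂ : DataStream X T, (∃ i, ∀ j, j ≠ i → S₁ j = S₂ j) →
    ∀ O : Set (Fin T → Hypothesis X), MeasurableSet O →
      A.law {ω | A.outputs S₁ ω ∈ O} ≤
        ENNReal.ofReal (Real.exp ε) * A.law {ω | A.outputs S₂ ω ∈ O}

end OnlineLearner

/-- The number of rounds `t` in which `h t` errs on the `t`-th example of `S`. -/
def mistakes {X : Type u} {T : ℕ} (h : Fin T → Hypothesis X) (S : DataStream X T) : ℕ :=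
  ∑ t, if h t (S t).1 ≠ (S t).2 then 1 else 0

/-- The expected regret of `A` on the stream `S` with respect to `H`. The infimum is a minimum of
natural numbers when `H` is nonempty. -/
noncomputable def expectedRegret {X : Type u} {T : ℕ} (A : OnlineLearner X T)
    (H : Set (Hypothesis X)) (S : DataStream X T) : ℝ :=
  ∫ ω, ((mistakes (A.outputs S ω) S : ℝ) -
    ((⨅ h : H, mistakes (fun _ => h.val) S : ℕ) : ℝ)) ∂A.law

/-! The proof turns the representation into finitely many experts, one of which is good in
expectation, and then runs a private version of multiplicative weights on them.

Experts: draw `n`, about `128 log T`, independent classes from the representation, and let the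
experts be the `k ^ n` majority votes that take one member from each class. Fix the best `h` in `H`.
Reweighting the points of the stream as in boosting, each fresh class contains in expectation a
member that shrinks the total weight by the factor `127/128`. Hence the best majority vote disagrees
with `h` on at most `(127/128) ^ n * T ≤ 1` rounds in expectation
(`lintegral_iInf_boostPotential_le`, `card_majority_ne_le`). The weights depend on the stream, but
they occur only in the analysis: the experts are drawn without looking at the data.

Privacy: sampling afresh from the multiplicative weights distribution in every round would cost
privacy in all `T` rounds. Instead a lazy Markov chain may resample only at rounds marked by
data-independent coins of bias `q = 1/√T`. The resampling rate is tuned so that, averaged over the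
coin, the chain carries each multiplicative weights distribution exactly to the next
(`sum_expWeight_mul_lazyKernel`), and the expected loss is unchanged. One changed example moves all
later loss counts by at most one, which costs a factor `(1 - δ)⁻¹ ^ 2` at marked rounds only, and it
changes the resampling rate in a single step (`lazyKernel_le_mul`). If more than `cap`, about `4√T`,
rounds are marked, the learner ignores the data. This makes the privacy pure, and the event is too
rare to matter for the regret.

With `δ` of order `min ε 1 / √T`, the regret `log (k ^ n) / δ + O(√T)` is of the claimed order. -/

/-! ### Multiplicative weights -/

section LossCount

variable {E : Type*}

/-- The number of rounds before `n` in which expert `j` errs. -/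
def lossCount (L : ℕ → E → Bool) (n : ℕ) (j : E) : ℕ := ∑ s ∈ Finset.range n, (L s j).toNat

lemma lossCount_succ (L : ℕ → E → Bool) (n : ℕ) (j : E) :
    lossCount L (n + 1) j = lossCount L n j + (L n j).toNat := by
  simp [lossCount, Finset.sum_range_succ]

lemma lossCount_le (L : ℕ → E → Bool) (n : ℕ) (j : E) : lossCount L n j ≤ n := by
  calc lossCount L n j ≤ ∑ s ∈ Finset.range n, 1 := Finset.sum_le_sum fun s _ => Bool.toNat_le _
    _ = n := by simp

end LossCount

section ExpWeight

variable {E : Type*} [Fintype E]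

/-- The distribution on experts with probabilities proportional to `(1 - δ) ^ N j`. -/
noncomputable def expWeight (δ : ℝ) (N : E → ℕ) (j : E) : ℝ :=
  (1 - δ) ^ N j / ∑ i, (1 - δ) ^ N i

lemma expWeight_nonneg {δ : ℝ} (hδ : δ < 1) (N : E → ℕ) (j : E) : 0 ≤ expWeight δ N j := by
  have : 0 < 1 - δ := by linarith
  unfold expWeight
  positivity

lemma sum_pow_pos [Nonempty E] {δ : ℝ} (hδ : δ < 1) (N : E → ℕ) : 0 < ∑ i, (1 - δ) ^ N i :=
  Finset.sum_pos (fun i _ => pow_pos (by linarith) _) Finset.univ_nonempty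

lemma sum_expWeight [Nonempty E] {δ : ℝ} (hδ : δ < 1) (N : E → ℕ) :
    ∑ j, expWeight δ N j = 1 := by
  unfold expWeight
  rw [← Finset.sum_div, div_self (sum_pow_pos hδ N).ne']

lemma expWeight_zero (δ : ℝ) (j : E) : expWeight δ (fun _ => 0) j = (Fintype.card E : ℝ)⁻¹ := by
  simp [expWeight]

/-- The numerator and the normalizing sum each change by a factor of at most `(1 - δ)⁻¹`, whatever
the number of experts. This is the privacy cost of one resampling. -/
lemma expWeight_le_mul [Nonempty E] {δ : ℝ} (hδ₀ : 0 ≤ δ) (hδ : δ < 1) {N N' : E → ℕ}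
    (h₁ : ∀ j, N j ≤ N' j + 1) (h₂ : ∀ j, N' j ≤ N j + 1) (j : E) :
    expWeight δ N j ≤ ((1 - δ)⁻¹) ^ 2 * expWeight δ N' j := by
  have hγ : 0 < 1 - δ := by linarith
  have key : ∀ {M M' : ℕ}, M ≤ M' + 1 → (1 - δ) * (1 - δ) ^ M' ≤ (1 - δ) ^ M := by
    intro M M' h
    rw [← pow_succ']
    exact pow_le_pow_of_le_one hγ.le (by linarith) h
  have hS := sum_pow_pos hδ N
  have hS' := sum_pow_pos hδ N'
  have hsum : (1 - δ) * ∑ i, (1 - δ) ^ N' i ≤ ∑ i, (1 - δ) ^ N i := by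
    rw [Finset.mul_sum]
    exact Finset.sum_le_sum fun i _ => key (h₁ i)
  have hj : (1 - δ) * (1 - δ) ^ N j ≤ (1 - δ) ^ N' j := key (h₂ j)
  unfold expWeight
  rw [inv_pow, ← div_eq_inv_mul, div_div, div_le_div_iff₀ hS (by positivity)]
  have hp : 0 < (1 - δ) ^ N j := by positivity
  calc (1 - δ) ^ N j * ((∑ i, (1 - δ) ^ N' i) * (1 - δ) ^ 2)
      = ((1 - δ) * (1 - δ) ^ N j) * ((1 - δ) * ∑ i, (1 - δ) ^ N' i) := by ring
    _ ≤ (1 - δ) ^ N' j * ∑ i, (1 - δ) ^ N i := by gcongr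

lemma pow_toNat (δ : ℝ) (b : Bool) : (1 - δ) ^ b.toNat = 1 - δ * (b.toNat : ℝ) := by
  cases b <;> simp

/-- The expected loss of the multiplicative weights distribution in round `n`. -/
noncomputable def mwLoss (δ : ℝ) (L : ℕ → E → Bool) (n : ℕ) : ℝ :=
  ∑ j, expWeight δ (lossCount L n) j * ((L n j).toNat : ℝ)

/-- An identity rather than an inequality, because `(1 - δ) ^ b` is affine in a bit `b`. The exact
invariance of the lazy chain depends on this. -/
lemma sum_pow_lossCount_succ [Nonempty E] {δ : ℝ} (hδ : δ < 1) (L : ℕ → E → Bool) (n : ℕ) :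
    ∑ j, (1 - δ) ^ lossCount L (n + 1) j =
      (∑ j, (1 - δ) ^ lossCount L n j) * (1 - δ * mwLoss δ L n) := by
  have hS := sum_pow_pos hδ (lossCount L n)
  have h : (∑ j, (1 - δ) ^ lossCount L n j) * mwLoss δ L n =
      ∑ j, (1 - δ) ^ lossCount L n j * ((L n j).toNat : ℝ) := by
    unfold mwLoss expWeight
    rw [Finset.mul_sum]
    refine Finset.sum_congr rfl fun j _ => ?_
    field_simp
  calc ∑ j, (1 - δ) ^ lossCount L (n + 1) j
      = ∑ j, ((1 - δ) ^ lossCount L n j - δ * ((1 - δ) ^ lossCount L n j * ((L n j).toNat : ℝ))) := by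
        refine Finset.sum_congr rfl fun j _ => ?_
        rw [lossCount_succ, pow_add, pow_toNat]; ring
    _ = _ := by rw [Finset.sum_sub_distrib, ← Finset.mul_sum, ← h]; ring

lemma sum_pow_lossCount_le [Nonempty E] {δ : ℝ} (hδ : δ < 1) (L : ℕ → E → Bool) (n : ℕ) :
    ∑ j, (1 - δ) ^ lossCount L n j ≤
      Fintype.card E * Real.exp (-(δ * ∑ t ∈ Finset.range n, mwLoss δ L t)) := by
  induction n with
  | zero => simp [lossCount]
  | succ n ih =>
    have hS := sum_pow_pos hδ (lossCount L n)
    rw [sum_pow_lossCount_succ hδ, Finset.sum_range_succ, mul_add, neg_add, Real.exp_add, ← mul_assoc]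
    have h1 : 1 - δ * mwLoss δ L n ≤ Real.exp (-(δ * mwLoss δ L n)) := by
      have := Real.add_one_le_exp (-(δ * mwLoss δ L n)); linarith
    calc _ ≤ (∑ j, (1 - δ) ^ lossCount L n j) * Real.exp (-(δ * mwLoss δ L n)) := by gcongr
      _ ≤ _ := by gcongr

/-- The regret bound of multiplicative weights. -/
lemma sum_mwLoss_le [Nonempty E] {δ : ℝ} (hδ₀ : 0 < δ) (hδ : δ ≤ 1 / 2) (L : ℕ → E → Bool) (n : ℕ)
    (j : E) :
    ∑ t ∈ Finset.range n, mwLoss δ L t ≤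
      Real.log (Fintype.card E) / δ + lossCount L n j + 2 * δ * lossCount L n j := by
  have hγ : 0 < 1 - δ := by linarith
  have hE : (0 : ℝ) < Fintype.card E := by exact_mod_cast Fintype.card_pos
  have h1 : (1 - δ) ^ lossCount L n j ≤ ∑ j, (1 - δ) ^ lossCount L n j :=
    Finset.single_le_sum (f := fun j => (1 - δ) ^ lossCount L n j)
      (fun i _ => (pow_pos hγ _).le) (Finset.mem_univ j)
  have h2 := Real.log_le_log (pow_pos hγ _)
    (h1.trans (sum_pow_lossCount_le (by linarith : δ < 1) L n))
  rw [Real.log_mul hE.ne' (Real.exp_pos _).ne', Real.log_exp, Real.log_pow] at h2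
  have h3 : -(δ + 2 * δ ^ 2) ≤ Real.log (1 - δ) := by
    have h4 := Real.one_sub_inv_le_log_of_pos hγ
    refine le_trans ?_ h4
    -- The product `(1 - δ) * (1 + δ + 2 * δ ^ 2)` equals `1 + δ ^ 2 * (1 - 2 * δ)`, so `δ ≤ 1 / 2`
    -- is exactly what is needed.
    have : (1 - δ)⁻¹ ≤ 1 + δ + 2 * δ ^ 2 := by
      rw [inv_le_iff_one_le_mul₀ hγ]
      nlinarith [mul_nonneg (sq_nonneg δ) (by linarith : (0:ℝ) ≤ 1 - 2 * δ)]
    linarith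
  have h5 : (lossCount L n j : ℝ) * -(δ + 2 * δ ^ 2) ≤ lossCount L n j * Real.log (1 - δ) := by
    gcongr
  have h6 : δ * ∑ t ∈ Finset.range n, mwLoss δ L t ≤
      Real.log (Fintype.card E) + lossCount L n j * (δ + 2 * δ ^ 2) := by linarith
  rw [← sub_nonneg]
  have : Real.log (Fintype.card E) / δ + lossCount L n j + 2 * δ * lossCount L n j -
      ∑ t ∈ Finset.range n, mwLoss δ L t = (Real.log (Fintype.card E) +
        lossCount L n j * (δ + 2 * δ ^ 2) - δ * ∑ t ∈ Finset.range n, mwLoss δ L t) / δ := by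
    field_simp
    ring
  rw [this]
  exact div_nonneg (by linarith) hδ₀.le

end ExpWeight

/-! ### The lazy kernel -/

section LazyKernel

variable {E : Type*} [Fintype E] [DecidableEq E]

/-- The probability of resampling at a potential switching time, depending on whether the current
expert has just erred. -/
noncomputable def switchRate (q δ : ℝ) (b : Bool) : ℝ :=
  1 / 2 + (1 - q / 2) * δ / q * b.toNat

/-- At a potential switching time (`c = true`), expert `i` is replaced, with probability
`switchRate`, by a fresh sample from the multiplicative weights distribution. -/
noncomputable def lazyKernel (q δ : ℝ) (c : Bool) (l : E → Bool) (N : E → ℕ) (i j : E) : ℝ :=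
  if c then switchRate q δ (l i) * expWeight δ N j +
    (1 - switchRate q δ (l i)) * (if i = j then 1 else 0)
  else if i = j then 1 else 0

lemma switchRate_bounds {q δ x : ℝ} (hx : x = (1 - q / 2) * δ / q) (hx₀ : 0 ≤ x) (b : Bool) :
    1 / 2 ≤ switchRate q δ b ∧ switchRate q δ b ≤ 1 / 2 + x := by
  unfold switchRate
  rw [← hx]
  cases b <;> simp [hx₀]

/-- The base rate `1 / 2` keeps both switching and staying away from probability zero, so an altered
loss bit changes either by a factor close to one. The worst ratio is `1 / 2` against `1 / 2 - x`. -/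
lemma switchRate_le_mul {q δ x : ℝ} (hx : x = (1 - q / 2) * δ / q) (hx₀ : 0 ≤ x) (hx₁ : x ≤ 1 / 4)
    (b b' : Bool) :
    switchRate q δ b ≤ (1 - 2 * x)⁻¹ * switchRate q δ b' ∧
      1 - switchRate q δ b ≤ (1 - 2 * x)⁻¹ * (1 - switchRate q δ b') := by
  obtain ⟨h1, h2⟩ := switchRate_bounds hx hx₀ b
  obtain ⟨h3, h4⟩ := switchRate_bounds hx hx₀ b'
  have hpos : 0 < 1 - 2 * x := by linarith
  rw [← div_eq_inv_mul, ← div_eq_inv_mul, le_div_iff₀ hpos, le_div_iff₀ hpos]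
  constructor <;> nlinarith

lemma lazyKernel_nonneg {q δ x : ℝ} (hδ : δ < 1) (hx : x = (1 - q / 2) * δ / q) (hx₀ : 0 ≤ x)
    (hx₁ : x ≤ 1 / 4) (c : Bool) (l : E → Bool) (N : E → ℕ) (i j : E) :
    0 ≤ lazyKernel q δ c l N i j := by
  obtain ⟨h1, h2⟩ := switchRate_bounds hx hx₀ (l i)
  have := expWeight_nonneg hδ N j
  have h3 : 0 ≤ 1 - switchRate q δ (l i) := by linarith
  have h4 : 0 ≤ switchRate q δ (l i) := by linarith
  unfold lazyKernel
  split_ifs <;> positivity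

lemma sum_lazyKernel [Nonempty E] {q δ : ℝ} (hδ : δ < 1) (c : Bool) (l : E → Bool) (N : E → ℕ)
    (i : E) : ∑ j, lazyKernel q δ c l N i j = 1 := by
  cases c
  · simp [lazyKernel]
  · simp only [lazyKernel, if_true, Finset.sum_add_distrib, ← Finset.mul_sum, sum_expWeight hδ]
    simp

/-- The privacy cost of one step has two separate sources: altered loss counts matter only if the
coin permits resampling, and the switching rate matters only if the latest losses differ. -/
lemma lazyKernel_le_mul [Nonempty E] {q δ x : ℝ} (hδ₀ : 0 ≤ δ) (hδ : δ < 1)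
    (hx : x = (1 - q / 2) * δ / q) (hx₀ : 0 ≤ x) (hx₁ : x ≤ 1 / 4) (c : Bool) {l l' : E → Bool}
    {N N' : E → ℕ} (h₁ : ∀ j, N j ≤ N' j + 1) (h₂ : ∀ j, N' j ≤ N j + 1) (i j : E) :
    lazyKernel q δ c l N i j ≤
      (if c then ((1 - δ)⁻¹) ^ 2 else 1) * (if l = l' then 1 else (1 - 2 * x)⁻¹) *
        lazyKernel q δ c l' N' i j := by
  have hγ : 0 < 1 - δ := by linarith
  have hR : 1 ≤ (1 - 2 * x)⁻¹ := by
    rw [one_le_inv₀ (by linarith)]; linarith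
  have hG : 1 ≤ ((1 - δ)⁻¹) ^ 2 := by
    apply one_le_pow₀
    rw [one_le_inv₀ hγ]; linarith
  set R : ℝ := if l = l' then 1 else (1 - 2 * x)⁻¹ with hRdef
  have hR1 : 1 ≤ R := by rw [hRdef]; split_ifs <;> simp [hR]
  have hr : switchRate q δ (l i) ≤ R * switchRate q δ (l' i) ∧
      1 - switchRate q δ (l i) ≤ R * (1 - switchRate q δ (l' i)) := by
    rw [hRdef]
    split_ifs with h
    · simp [h]
    · exact switchRate_le_mul hx hx₀ hx₁ _ _
  have hp := expWeight_le_mul hδ₀ hδ h₁ h₂ j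
  have hp₀ := expWeight_nonneg hδ N j
  obtain ⟨b1, b2⟩ := switchRate_bounds hx hx₀ (l' i)
  have b3 : 0 ≤ 1 - switchRate q δ (l' i) := by linarith
  cases c
  · simp only [lazyKernel, Bool.false_eq_true, if_false, one_mul]
    split_ifs <;> simp [hR1]
  · simp only [lazyKernel, if_true]
    have e1 : switchRate q δ (l i) * expWeight δ N j ≤
        (R * switchRate q δ (l' i)) * (((1 - δ)⁻¹) ^ 2 * expWeight δ N' j) :=
      mul_le_mul hr.1 hp hp₀ (by positivity)
    have e2 : (1 - switchRate q δ (l i)) * (if i = j then 1 else 0) ≤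
        (((1 - δ)⁻¹) ^ 2 * (R * (1 - switchRate q δ (l' i)))) * (if i = j then 1 else 0) := by
      have : 1 - switchRate q δ (l i) ≤ ((1 - δ)⁻¹) ^ 2 * (R * (1 - switchRate q δ (l' i))) :=
        hr.2.trans (le_mul_of_one_le_left (by positivity) hG)
      split_ifs <;> simp only [mul_one, mul_zero, le_refl, this]
    calc _ ≤ _ := add_le_add e1 e2
      _ = _ := by ring

/-- Averaged over the coin, the lazy kernel moves the multiplicative weights distribution of round
`n` to that of round `n + 1`. -/
lemma sum_expWeight_mul_lazyKernel [Nonempty E] {q δ : ℝ} (hq : 0 < q) (hδ : δ < 1)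
    (L : ℕ → E → Bool) (n : ℕ) (j : E) :
    ∑ i, expWeight δ (lossCount L n) i *
      (q * lazyKernel q δ true (L n) (lossCount L (n + 1)) i j +
        (1 - q) * lazyKernel q δ false (L n) (lossCount L (n + 1)) i j) =
      expWeight δ (lossCount L (n + 1)) j := by
  set p := expWeight δ (lossCount L n) with hp
  set p' := expWeight δ (lossCount L (n + 1)) with hp'
  -- Averaged over the coin, expert `i` survives with probability `(1 - q / 2) * (1 - δ * loss)`,
  -- since `q * switchRate = q / 2 + (1 - q / 2) * δ * loss`. Survival thus performs the
  -- multiplicative update up to a constant, and the lost mass is redistributed according to `p'`.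
  have h1 : ∀ i, p i * (q * lazyKernel q δ true (L n) (lossCount L (n + 1)) i j +
        (1 - q) * lazyKernel q δ false (L n) (lossCount L (n + 1)) i j) =
      p' j * (q / 2 * p i + (1 - q / 2) * δ * (p i * (L n i).toNat)) +
        (if i = j then p i * ((1 - q / 2) * (1 - δ * (L n i).toNat)) else 0) := by
    intro i
    simp only [lazyKernel, switchRate, if_true, Bool.false_eq_true, if_false, ← hp']
    split_ifs <;> field_simp <;> ring
  simp only [h1, Finset.sum_add_distrib, ← Finset.mul_sum, Finset.sum_ite_eq', Finset.mem_univ,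
    if_true]
  rw [hp, sum_expWeight hδ]
  change p' j * (q / 2 * 1 + (1 - q / 2) * δ * mwLoss δ L n) + _ = _
  have h2 : p j * (1 - δ * (L n j).toNat) = p' j * (1 - δ * mwLoss δ L n) := by
    have hS := sum_pow_pos hδ (lossCount L n)
    have hS' := sum_pow_pos hδ (lossCount L (n + 1))
    have hs := sum_pow_lossCount_succ hδ L n
    rw [hs] at hS'
    have hne : (1 - δ * mwLoss δ L n) ≠ 0 := (pos_of_mul_pos_right hS' hS.le).ne'
    rw [hp, hp']
    unfold expWeight
    rw [hs, lossCount_succ, pow_add, pow_toNat]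
    field_simp
  rw [← hp, mul_left_comm, h2]
  ring

end LazyKernel

/-! ### Path weights of finite Markov chains -/

section ChainWeight

variable {E : Type*}

/-- The probability that the chain with transition probabilities `κ`, started at `i`, follows the
path `σ`. -/
noncomputable def chainWeight {n : ℕ} (κ : Fin n → E → E → ℝ) (i : E) (σ : Fin n → E) : ℝ :=
  ∏ t, κ t ((Fin.cons i σ : Fin (n + 1) → E) t.castSucc) (σ t)

lemma chainWeight_cons {n : ℕ} (κ : Fin (n + 1) → E → E → ℝ) (i b : E) (σ : Fin n → E) :
    chainWeight κ i (Fin.cons b σ : Fin (n + 1) → E) =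
      κ 0 i b * chainWeight (fun t => κ t.succ) b σ := by
  unfold chainWeight
  rw [Fin.prod_univ_succ]
  simp

lemma sum_pi_succ {n : ℕ} [Fintype E] (F : (Fin (n + 1) → E) → ℝ) :
    ∑ σ, F σ = ∑ b, ∑ σ : Fin n → E, F (Fin.cons b σ : Fin (n + 1) → E) := by
  rw [← (Fin.consEquiv fun _ => E).sum_comp, Fintype.sum_prod_type]
  rfl

lemma sum_chainWeight [Fintype E] {n : ℕ} (κ : Fin n → E → E → ℝ)
    (hκ : ∀ t i, ∑ j, κ t i j = 1) (i : E) : ∑ σ, chainWeight κ i σ = 1 := by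
  induction n generalizing i with
  | zero => simp [chainWeight]
  | succ n ih =>
    rw [sum_pi_succ]
    simp only [chainWeight_cons, ← Finset.mul_sum, ih (fun t => κ t.succ) (fun t => hκ t.succ),
      mul_one, hκ]

/-- If the kernels move `m t` to `m (t + 1)`, then the state after step `t` has law `m (t + 1)`. -/
lemma sum_chainWeight_apply [Fintype E] {n : ℕ} (κ : Fin n → E → E → ℝ)
    (hκ : ∀ t i, ∑ j, κ t i j = 1) (m : ℕ → E → ℝ)
    (hm : ∀ (t : Fin n) j, ∑ i, m t i * κ t i j = m (t + 1) j) (g : E → ℝ) (t : Fin n) :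
    ∑ i, m 0 i * ∑ σ, chainWeight κ i σ * g (σ t) = ∑ j, m (t + 1) j * g j := by
  induction n generalizing m with
  | zero => exact t.elim0
  | succ n ih =>
    have step : ∀ f : E → ℝ, ∑ i, m 0 i * ∑ b, κ 0 i b * f b = ∑ b, m 1 b * f b := by
      intro f
      simp only [Finset.mul_sum]
      rw [Finset.sum_comm]
      refine Finset.sum_congr rfl fun b _ => ?_
      have := hm 0 b
      simp only [Fin.val_zero, zero_add] at this
      rw [← this, Finset.sum_mul]
      exact Finset.sum_congr rfl fun i _ => by ring
    simp only [sum_pi_succ, chainWeight_cons, mul_assoc, ← Finset.mul_sum]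
    rw [step fun b => ∑ σ : Fin n → E, chainWeight (fun t => κ t.succ) b σ *
      g ((Fin.cons b σ : Fin (n + 1) → E) t)]
    induction t using Fin.cases with
    | zero =>
      simp only [Fin.cons_zero, ← Finset.sum_mul,
        sum_chainWeight (fun t => κ t.succ) (fun t => hκ t.succ), one_mul, Fin.val_zero, zero_add]
    | succ t =>
      simp only [Fin.cons_succ]
      exact ih (fun t => κ t.succ) (fun t => hκ t.succ) (fun s => m (s + 1))
        (fun s j => hm s.succ j) t

/-- The coins of different steps are independent, so by distributivity averaging over all of them is
the same as averaging each kernel over its own coin. -/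
lemma sum_prod_mul_chainWeight {n : ℕ} (β : Bool → ℝ) (κ : Fin n → Bool → E → E → ℝ) (i : E)
    (σ : Fin n → E) :
    ∑ C : Fin n → Bool, (∏ t, β (C t)) * chainWeight (fun t => κ t (C t)) i σ =
      chainWeight (fun t i j => ∑ c, β c * κ t c i j) i σ := by
  unfold chainWeight
  simp only [← Finset.prod_mul_distrib]
  rw [Finset.prod_univ_sum, Fintype.piFinset_univ]

end ChainWeight

/-! ### Boosting a probabilistic representation -/

section Boosting

variable {X : Type u}

/-- The factor by which boosting changes the weight of an example on which the chosen hypothesis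
is wrong (`b = true`) or right (`b = false`). -/
noncomputable def boostFactor (b : Bool) : ℝ≥0∞ := 7 / 8 + 15 / 56 * (if b then 1 else 0)

/-- The majority vote of the hypotheses `V r (f r)`. -/
def majority {n k : ℕ} (V : Fin n → Fin k → Hypothesis X) (f : Fin n → Fin k) : Hypothesis X :=
  fun x => decide (n < 2 * (Finset.univ.filter fun r => V r (f r) x = true).card)

/-- The total weight of the examples after boosting with the hypotheses `V r (f r)`. -/
noncomputable def boostPotential {n k T : ℕ} (h : Hypothesis X) (x : Fin T → X)
    (w : Fin T → ℝ≥0∞) (V : Fin n → Fin k → Hypothesis X) (f : Fin n → Fin k) : ℝ≥0∞ :=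
  ∑ t, w t * ∏ r, boostFactor (V r (f r) (x t) != h (x t))

lemma boostFactor_ne_top (b : Bool) : boostFactor b ≠ ∞ := by
  unfold boostFactor
  cases b <;> simp [ENNReal.div_eq_top]

lemma measurable_boost_term {k : ℕ} (h : Hypothesis X) (y : X) (i : Fin k) :
    Measurable fun v : Fin k → Hypothesis X => boostFactor (v i y != h y) :=
  (Measurable.of_discrete (f := fun b : Bool => boostFactor (b != h y))).comp (by fun_prop)

lemma measurable_boostPotential {n k T : ℕ} (h : Hypothesis X) (x : Fin T → X)
    (w : Fin T → ℝ≥0∞) (f : Fin n → Fin k) :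
    Measurable fun V : Fin n → Fin k → Hypothesis X => boostPotential h x w V f := by
  unfold boostPotential
  refine Finset.measurable_sum _ fun t _ => Measurable.const_mul ?_ _
  refine Finset.measurable_prod _ fun r _ => ?_
  exact (measurable_boost_term h (x t) (f r)).comp (measurable_pi_apply r)

/-- One round of boosting with a random class of a probabilistic representation. -/
lemma lintegral_iInf_boost_le {k T : ℕ} {H : Set (Hypothesis X)}
    {P : Measure (Fin k → Hypothesis X)} [IsProbabilityMeasure P] (hk : 1 ≤ k)
    (hP : IsProbRep (1 / 4) (1 / 4) H P) {h : Hypothesis X} (hh : h ∈ H) (x : Fin T → X)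
    (w : Fin T → ℝ≥0∞) (hw : ∀ t, w t ≠ ∞) :
    ∫⁻ v, ⨅ i, ∑ t, w t * boostFactor (v i (x t) != h (x t)) ∂P ≤
      127 / 128 * ∑ t, w t := by
  classical
  set W := ∑ t, w t with hW
  have hWtop : W ≠ ∞ := by simp [hW, ENNReal.sum_eq_top, hw]
  have hsplit : ∀ (v : Fin k → Hypothesis X) i,
      ∑ t, w t * boostFactor (v i (x t) != h (x t)) =
        7 / 8 * W + 15 / 56 * ∑ t, w t * (if v i (x t) ≠ h (x t) then 1 else 0) := by
    intro v i
    rw [hW, Finset.mul_sum, Finset.mul_sum, ← Finset.sum_add_distrib]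
    refine Finset.sum_congr rfl fun t _ => ?_
    by_cases hv : v i (x t) = h (x t) <;> simp [boostFactor, hv] <;> ring
  -- Zero total weight cannot be normalized to a distribution. Otherwise the representation is
  -- applied to the normalized weights on the points of the stream, labeled by `h`.
  by_cases hW0 : W = 0
  · have : ∀ t, w t = 0 := by simpa [hW] using hW0
    have hne : Nonempty (Fin k) := ⟨⟨0, hk⟩⟩
    simp [this]
  have hts : ∑' t, w t = W := tsum_fintype _
  set D : PMF (X × Bool) := (PMF.normalize w (hts ▸ hW0) (hts ▸ hWtop)).map
    fun t => (x t, h (x t)) with hD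
  have hlab : LabeledBy D h := by
    intro p hp
    rw [hD, PMF.support_map] at hp
    obtain ⟨t, -, rfl⟩ := hp
    rfl
  have herr : ∀ v : Hypothesis X,
      err D v = (∑ t, w t * (if v (x t) ≠ h (x t) then 1 else 0)) * W⁻¹ := by
    intro v
    rw [err, hD, PMF.toOuterMeasure_map_apply, PMF.toOuterMeasure_apply_fintype, Finset.sum_mul]
    refine Finset.sum_congr rfl fun t _ => ?_
    by_cases hv : v (x t) = h (x t) <;>
      simp [hv, PMF.normalize_apply, hW]
  set G : Set (Fin k → Hypothesis X) := {v | ∃ i, err D (v i) ≤ 1 / 4} with hG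
  have hGm : MeasurableSet G := by
    have : G = ⋃ i, {v | err D (v i) ≤ 1 / 4} := by ext v; simp [hG]
    rw [this]
    refine MeasurableSet.iUnion fun i => measurableSet_le ?_ measurable_const
    simp only [herr]
    refine Measurable.mul_const (Finset.measurable_sum _ fun t _ => Measurable.const_mul ?_ _) _
    exact (Measurable.of_discrete (f := fun b : Bool => if b ≠ h (x t) then (1 : ℝ≥0∞) else 0)).comp
      (by fun_prop : Measurable fun v : Fin k → Hypothesis X => v i (x t))
  have hGc : P Gᶜ ≤ 1 / 4 := by
    have h1 : 1 - 1 / 4 ≤ P G := hP h hh D hlab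
    rw [prob_compl_eq_one_sub hGm]
    refine tsub_le_iff_left.2 ?_
    exact tsub_le_iff_right.1 h1
  -- On the good event some member has weighted error at most `1 / 4`; off it the error is bounded
  -- trivially by `1 = 1/4 + 3/4`.
  have hpt : ∀ v : Fin k → Hypothesis X,
      ⨅ i, ∑ t, w t * boostFactor (v i (x t) != h (x t)) ≤
        7 / 8 * W + 15 / 56 * W * (1 / 4 + 3 / 4 * Gᶜ.indicator 1 v) := by
    intro v
    by_cases hv : v ∈ G
    · obtain ⟨i, hi⟩ := hv
      refine (iInf_le _ i).trans ?_
      rw [hsplit, mul_assoc]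
      gcongr
      rw [herr, ← div_eq_mul_inv, ENNReal.div_le_iff hW0 hWtop] at hi
      rw [mul_comm W]
      refine hi.trans ?_
      gcongr
      exact le_self_add
    · refine (iInf_le _ ⟨0, hk⟩).trans ?_
      rw [hsplit, mul_assoc]
      have e : (1 / 4 + 3 / 4 : ℝ≥0∞) = 1 := by
        rw [ENNReal.div_add_div_same]; norm_num
        exact ENNReal.div_self (by norm_num) (by norm_num)
      simp only [Set.indicator_of_mem (Set.mem_compl hv), Pi.one_apply, mul_one, e]
      gcongr
      rw [hW]
      refine Finset.sum_le_sum fun t _ => ?_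
      split_ifs <;> simp
  calc _ ≤ ∫⁻ v, 7 / 8 * W + 15 / 56 * W * (1 / 4 + 3 / 4 * Gᶜ.indicator 1 v) ∂P :=
        lintegral_mono hpt
    _ = 7 / 8 * W + 15 / 56 * W * (1 / 4 + 3 / 4 * P Gᶜ) := by
        have hi : Measurable (Gᶜ.indicator (1 : (Fin k → Hypothesis X) → ℝ≥0∞)) :=
          measurable_one.indicator hGm.compl
        rw [lintegral_add_left measurable_const, lintegral_const,
          lintegral_const_mul _ (by fun_prop), lintegral_add_left measurable_const, lintegral_const_mul _ hi,
          lintegral_indicator_one hGm.compl]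
        simp
    _ ≤ 7 / 8 * W + 15 / 56 * W * (1 / 4 + 3 / 4 * (1 / 4)) := by gcongr
    _ = 127 / 128 * W := by
        -- The expected error of the best member is at most `7 / 16`. Being below `1 / 2`, it gives
        -- a contraction.
        have e : (7 / 8 + 15 / 56 * (1 / 4 + 3 / 4 * (1 / 4)) : ℝ≥0∞) = 127 / 128 := by
          rw [← ENNReal.toReal_eq_toReal_iff' (by finiteness) (by finiteness)]
          rw [ENNReal.toReal_add (by finiteness) (by finiteness), ENNReal.toReal_mul,
            ENNReal.toReal_add (by finiteness) (by finiteness)]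
          norm_num
        rw [← e]; ring

lemma boostPotential_cons {n k T : ℕ} (h : Hypothesis X) (x : Fin T → X) (w : Fin T → ℝ≥0∞)
    (v : Fin k → Hypothesis X) (V : Fin n → Fin k → Hypothesis X) (i : Fin k)
    (f : Fin n → Fin k) :
    boostPotential h x w (Fin.cons v V : Fin (n + 1) → Fin k → Hypothesis X)
        (Fin.cons i f : Fin (n + 1) → Fin k) =
      boostPotential h x (fun t => w t * boostFactor (v i (x t) != h (x t))) V f := by
  unfold boostPotential
  simp [Fin.prod_univ_succ, mul_assoc]

/-- Boosting with `n` independent random classes. -/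
lemma lintegral_iInf_boostPotential_le {k T : ℕ} {H : Set (Hypothesis X)}
    {P : Measure (Fin k → Hypothesis X)} [IsProbabilityMeasure P] (hk : 1 ≤ k)
    (hP : IsProbRep (1 / 4) (1 / 4) H P) {h : Hypothesis X} (hh : h ∈ H) (x : Fin T → X)
    (n : ℕ) (w : Fin T → ℝ≥0∞) (hw : ∀ t, w t ≠ ∞) :
    ∫⁻ V, ⨅ f, boostPotential h x w V f ∂(Measure.pi fun _ : Fin n => P) ≤
      (127 / 128) ^ n * ∑ t, w t := by
  induction n generalizing w with
  | zero =>
    simp [boostPotential]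
  | succ n ih =>
    have hmp := (measurePreserving_piFinSuccAbove (fun _ : Fin (n + 1) => P) 0).symm
    have hmeas : Measurable fun V : Fin (n + 1) → Fin k → Hypothesis X =>
        ⨅ f, boostPotential h x w V f :=
      Measurable.iInf fun f => measurable_boostPotential h x w f
    rw [← hmp.lintegral_comp hmeas]
    refine (lintegral_prod _ (hmeas.comp hmp.measurable).aemeasurable).trans_le ?_
    simp only [Function.comp_apply]
    -- With the first class fixed, the expected infimum over the remaining choices is bounded for
    -- each first choice `i` separately, by induction with the updated weights. The infimum over `i`
    -- is then taken outside the integral.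
    have hv : ∀ v : Fin k → Hypothesis X,
        ∫⁻ V, ⨅ f, boostPotential h x w
          ((MeasurableEquiv.piFinSuccAbove (fun _ => Fin k → Hypothesis X) 0).symm (v, V)) f
          ∂(Measure.pi fun _ : Fin n => P) ≤
        (127 / 128) ^ n * ⨅ i, ∑ t, w t * boostFactor (v i (x t) != h (x t)) := by
      intro v
      have hne : Nonempty (Fin k) := ⟨⟨0, hk⟩⟩
      rw [ENNReal.mul_iInf_of_ne (pow_ne_zero _ (by simp)) (by finiteness)]
      refine le_iInf fun i => ?_
      refine le_trans (lintegral_mono fun V => ?_)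
        (ih (fun t => w t * boostFactor (v i (x t) != h (x t)))
          fun t => ENNReal.mul_ne_top (hw t) (boostFactor_ne_top _))
      refine le_iInf fun f => (iInf_le _ (Fin.cons i f : Fin (n + 1) → Fin k)).trans ?_
      rw [← boostPotential_cons]
      simp [MeasurableEquiv.piFinSuccAbove, Fin.insertNthEquiv]
    calc _ ≤ ∫⁻ v, (127 / 128) ^ n * ⨅ i, ∑ t, w t * boostFactor (v i (x t) != h (x t)) ∂P :=
          lintegral_mono hv
      _ = (127 / 128) ^ n * ∫⁻ v, ⨅ i, ∑ t, w t * boostFactor (v i (x t) != h (x t)) ∂P :=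
          lintegral_const_mul' _ _ (by finiteness)
      _ ≤ (127 / 128) ^ n * (127 / 128 * ∑ t, w t) := by
          gcongr
          exact lintegral_iInf_boost_le hk hP hh x w hw
      _ = _ := by rw [pow_succ, mul_assoc]

/-- The two factors are the reciprocals `8 / 7` and `7 / 8`, so right and wrong votes cancel in
pairs. Ties are included and count against the majority. -/
lemma one_le_prod_boostFactor {n : ℕ} (b : Fin n → Bool)
    (hb : n ≤ 2 * (Finset.univ.filter fun r => b r = true).card) :
    1 ≤ ∏ r, boostFactor (b r) := by
  have h1 : ∀ c, boostFactor c = ENNReal.ofReal (if c then 8 / 7 else 7 / 8) := by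
    intro c
    unfold boostFactor
    rw [← ENNReal.ofReal_toReal (a := 7 / 8 + 15 / 56 * (if c then 1 else 0)) (by
      exact boostFactor_ne_top c)]
    congr 1
    cases c
    · simp
    · rw [ENNReal.toReal_add (by finiteness) (by simp; finiteness)]
      norm_num
  simp only [h1]
  rw [← ENNReal.ofReal_prod_of_nonneg (fun r _ => by split_ifs <;> norm_num), ENNReal.one_le_ofReal,
    Finset.prod_ite, Finset.prod_const, Finset.prod_const]
  have hcard : (Finset.univ.filter fun r => b r = true).card +
      (Finset.univ.filter fun r => ¬ b r = true).card = n := by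
    rw [Finset.card_filter_add_card_filter_not]; simp
  obtain ⟨d, hd⟩ : ∃ d, (Finset.univ.filter fun r => b r = true).card =
      (Finset.univ.filter fun r => ¬ b r = true).card + d := Nat.exists_eq_add_of_le (by omega)
  rw [hd, pow_add, mul_right_comm, ← mul_pow]
  norm_num
  exact one_le_pow₀ (by norm_num)

/-- The boosting potential bounds the number of points on which the majority vote is wrong. -/
lemma card_majority_ne_le {n k T : ℕ} (h : Hypothesis X) (x : Fin T → X)
    (V : Fin n → Fin k → Hypothesis X) (f : Fin n → Fin k) :
    ((∑ t, if majority V f (x t) ≠ h (x t) then 1 else 0 : ℕ) : ℝ≥0∞) ≤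
      boostPotential h x (fun _ => 1) V f := by
  unfold boostPotential
  push_cast
  refine Finset.sum_le_sum fun t _ => ?_
  split_ifs with hne
  · rw [one_mul]
    refine one_le_prod_boostFactor _ ?_
    have hcard : (Finset.univ.filter fun r => V r (f r) (x t) = true).card +
        (Finset.univ.filter fun r => ¬ V r (f r) (x t) = true).card = n := by
      rw [Finset.card_filter_add_card_filter_not]; simp
    unfold majority at hne
    cases hx : h (x t)
    · simp only [hx, ne_eq, decide_eq_false_iff_not, not_not] at hne
      simp only [Bool.bne_false]
      omega
    · simp only [hx, ne_eq, decide_eq_true_eq, not_lt] at hne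
      simp only [Bool.bne_true, Bool.not_eq_true'] at hcard ⊢
      simp only [Bool.not_eq_true] at hcard
      omega
  · simp

lemma measurable_majority {n k : ℕ} (f : Fin n → Fin k) :
    Measurable fun V : Fin n → Fin k → Hypothesis X => majority V f := by
  refine measurable_pi_lambda _ fun x => ?_
  exact (Measurable.of_discrete (f := fun b : Fin n → Bool =>
    decide (n < 2 * (Finset.univ.filter fun r => b r = true).card))).comp
    (by fun_prop : Measurable fun (V : Fin n → Fin k → Hypothesis X) r => V r (f r) x)

end Boosting

/-! ### Running a finite Markov chain with pre-drawn randomness -/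

section ChainPath

variable {R E : Type*} {T : ℕ}

/-- The state after `m` steps of the chain started at `i`: step `t` moves from state `e` to
`ω t (r t, e)`, where `r t` is the input of step `t` and `ω` the internal randomness. -/
def chainState (r : Fin T → R) (i : E) (ω : Fin T → R × E → E) : ℕ → E
  | 0 => i
  | m + 1 => if h : m < T then ω ⟨m, h⟩ (r ⟨m, h⟩, chainState r i ω m) else chainState r i ω m

/-- The sequence of states visited by the chain after the starting state. -/
def chainPath (r : Fin T → R) (i : E) (ω : Fin T → R × E → E) : Fin T → E :=
  fun t => chainState r i ω (t + 1)

lemma chainState_congr {r r' : Fin T → R} (i : E) (ω : Fin T → R × E → E) {m : ℕ}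
    (h : ∀ t : Fin T, t.val < m → r t = r' t) : chainState r i ω m = chainState r' i ω m := by
  induction m with
  | zero => rfl
  | succ m ih =>
    have ih' := ih fun t ht => h t (by omega)
    simp only [chainState, ih']
    split_ifs with hm
    · rw [h ⟨m, hm⟩ (Nat.lt_succ_self m)]
    · rfl

lemma chainPath_succ (r : Fin T → R) (i : E) (ω : Fin T → R × E → E) (t : Fin T) :
    chainPath r i ω t = ω t (r t, chainState r i ω t) := by
  simp [chainPath, chainState]

lemma chainPath_eq_iff (r : Fin T → R) (i : E) (ω : Fin T → R × E → E) (σ : Fin T → E) :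
    chainPath r i ω = σ ↔
      ∀ t, ω t (r t, (Fin.cons i σ : Fin (T + 1) → E) t.castSucc) = σ t := by
  constructor
  · rintro rfl t
    have : (Fin.cons i (chainPath r i ω) : Fin (T + 1) → E) t.castSucc = chainState r i ω t := by
      obtain ⟨m, hm⟩ := t
      cases m with
      | zero => rfl
      | succ m => rfl
    rw [this, chainPath_succ]
  · intro h
    have key : ∀ m (hm : m < T + 1),
        chainState r i ω m = (Fin.cons i σ : Fin (T + 1) → E) ⟨m, hm⟩ := by
      intro m
      induction m with
      | zero => intro _; rfl
      | succ m ih =>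
        intro hm
        have hm' : m < T := by omega
        simp only [chainState, hm', dif_pos, ih (by omega)]
        exact h ⟨m, hm'⟩
    funext t
    exact key (t + 1) (by omega)

/-- A probability mass function with prescribed real values. -/
lemma exists_pmf_eq_ofReal {A : Type*} [Fintype A] (p : A → ℝ) (h₀ : ∀ a, 0 ≤ p a)
    (h₁ : ∑ a, p a = 1) : ∃ μ : PMF A, ∀ a, μ a = ENNReal.ofReal (p a) :=
  ⟨PMF.ofFintype (fun a => ENNReal.ofReal (p a)) (by
    rw [← ENNReal.ofReal_sum_of_nonneg fun a _ => h₀ a, h₁, ENNReal.ofReal_one]), fun a => rfl⟩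

variable [Fintype R] [Fintype E] [MeasurableSpace E] [MeasurableSingletonClass E]

/-- The law of the internal randomness: all values `ω t (r, e)` are drawn independently, from
`K r e`. -/
noncomputable def chainLaw (T : ℕ) (K : R → E → PMF E) : Measure (Fin T → R × E → E) :=
  Measure.pi fun _ => Measure.pi fun re => (K re.1 re.2).toMeasure

instance (T : ℕ) (K : R → E → PMF E) : IsProbabilityMeasure (chainLaw T K) := by
  unfold chainLaw; infer_instance

/-- Following a prescribed path constrains one coordinate of `ω t` for each `t`, and these are
independent. Drawing the answers to all inputs in advance makes the seed independent of the data. -/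
lemma chainLaw_path_eq (K : R → E → PMF E) (r : Fin T → R) (i : E) (σ : Fin T → E) :
    chainLaw T K {ω | chainPath r i ω = σ} =
      ∏ t, K (r t) ((Fin.cons i σ : Fin (T + 1) → E) t.castSucc) (σ t) := by
  classical
  have h : {ω : Fin T → R × E → E | chainPath r i ω = σ} = Set.univ.pi fun t =>
      Function.eval (r t, (Fin.cons i σ : Fin (T + 1) → E) t.castSucc) ⁻¹' ({σ t} : Set E) := by
    ext ω
    simp [chainPath_eq_iff]
  rw [h, chainLaw, Measure.pi_pi]
  refine Finset.prod_congr rfl fun t _ => ?_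
  rw [(measurePreserving_eval (fun re : R × E => (K re.1 re.2).toMeasure) _).measure_preimage
    (measurableSet_singleton _).nullMeasurableSet, PMF.toMeasure_apply_singleton _ _
    (measurableSet_singleton _)]

lemma measurable_chainPath (r : Fin T → R) (i : E) :
    Measurable fun ω : Fin T → R × E → E => chainPath r i ω :=
  Measurable.of_discrete

variable {κ : R → E → E → ℝ} {K : R → E → PMF E}

lemma chainLaw_path_eq_ofReal (h₀ : ∀ r i j, 0 ≤ κ r i j)
    (hK : ∀ r i j, K r i j = ENNReal.ofReal (κ r i j)) (r : Fin T → R) (i : E) (σ : Fin T → E) :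
    chainLaw T K {ω | chainPath r i ω = σ} =
      ENNReal.ofReal (chainWeight (fun t => κ (r t)) i σ) := by
  rw [chainLaw_path_eq, chainWeight, ENNReal.ofReal_prod_of_nonneg fun t _ => h₀ _ _ _]
  simp only [hK]

lemma integral_chainPath (h₀ : ∀ r i j, 0 ≤ κ r i j)
    (hK : ∀ r i j, K r i j = ENNReal.ofReal (κ r i j)) (r : Fin T → R) (i : E)
    (F : (Fin T → E) → ℝ) :
    ∫ ω, F (chainPath r i ω) ∂chainLaw T K =
      ∑ σ, chainWeight (fun t => κ (r t)) i σ * F σ := by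
  have hm := measurable_chainPath (T := T) r i
  rw [← integral_map (f := F) hm.aemeasurable Measurable.of_discrete.aestronglyMeasurable]
  have : IsProbabilityMeasure ((chainLaw T K).map fun ω => chainPath r i ω) :=
    Measure.isProbabilityMeasure_map hm.aemeasurable
  rw [integral_fintype Integrable.of_finite]
  refine Finset.sum_congr rfl fun σ _ => ?_
  rw [measureReal_def, Measure.map_apply hm (measurableSet_singleton σ)]
  change (chainLaw T K {ω | chainPath r i ω = σ}).toReal • _ = _
  rw [chainLaw_path_eq_ofReal h₀ hK, ENNReal.toReal_ofReal, smul_eq_mul]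
  exact Finset.prod_nonneg fun t _ => h₀ _ _ _

/-- Stepwise domination of the kernels multiplies along each path, and summing over the paths gives
all events. -/
lemma chainLaw_path_mem_le (h₀ : ∀ r i j, 0 ≤ κ r i j)
    (hK : ∀ r i j, K r i j = ENNReal.ofReal (κ r i j)) {r r' : Fin T → R} (i : E) {c : Fin T → ℝ}
    {B : ℝ} (hc : ∀ t, 0 ≤ c t) (hB : ∏ t, c t ≤ B)
    (hκ : ∀ t i j, κ (r t) i j ≤ c t * κ (r' t) i j) (O : Set (Fin T → E)) :
    chainLaw T K {ω | chainPath r i ω ∈ O} ≤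
      ENNReal.ofReal B * chainLaw T K {ω | chainPath r' i ω ∈ O} := by
  classical
  have hsum : ∀ r : Fin T → R, chainLaw T K {ω | chainPath r i ω ∈ O} =
      ∑ σ ∈ Finset.univ.filter (· ∈ O), chainLaw T K {ω | chainPath r i ω = σ} := by
    intro r
    rw [← measure_biUnion_finset]
    · congr 1; ext ω; simp
    · intro a _ b _ hab
      refine Set.disjoint_left.2 fun ω h1 h2 => hab (h1.symm.trans h2)
    · intro σ _; exact MeasurableSet.of_discrete
  rw [hsum, hsum, Finset.mul_sum]
  refine Finset.sum_le_sum fun σ _ => ?_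
  rw [chainLaw_path_eq_ofReal h₀ hK, chainLaw_path_eq_ofReal h₀ hK,
    ← ENNReal.ofReal_mul ((Finset.prod_nonneg fun t _ => hc t).trans hB)]
  refine ENNReal.ofReal_le_ofReal ?_
  calc chainWeight (fun t => κ (r t)) i σ
      ≤ ∏ t, c t * κ (r' t) ((Fin.cons i σ : Fin (T + 1) → E) t.castSucc) (σ t) :=
        Finset.prod_le_prod (fun t _ => h₀ _ _ _) fun t _ => hκ t _ _
    _ = (∏ t, c t) * chainWeight (fun t => κ (r' t)) i σ := Finset.prod_mul_distrib
    _ ≤ B * _ := mul_le_mul_of_nonneg_right hB (Finset.prod_nonneg fun t _ => h₀ _ _ _)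

end ChainPath

/-! ### Expected loss and number of coins of the lazy chain -/

lemma lossCount_le_add_one {E : Type*} {L L' : ℕ → E → Bool} {d : ℕ} (h : ∀ s, s ≠ d → L s = L' s) (n : ℕ)
    (j : E) : lossCount L n j ≤ lossCount L' n j + 1 := by
  unfold lossCount
  calc ∑ s ∈ Finset.range n, (L s j).toNat
      ≤ ∑ s ∈ Finset.range n, ((L' s j).toNat + if s = d then 1 else 0) := by
        refine Finset.sum_le_sum fun s _ => ?_
        split_ifs with hs
        · exact (Bool.toNat_le _).trans (by omega)
        · rw [h s hs]; simp
    _ ≤ _ := by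
        rw [Finset.sum_add_distrib, Finset.sum_ite_eq']
        split_ifs <;> simp

section LazyChain

variable {E : Type*} [Fintype E] [DecidableEq E]

/-- The probabilities of a coin that marks a round as a potential switching time. -/
def coinWeight (q : ℝ) (c : Bool) : ℝ := if c then q else 1 - q

lemma coinWeight_nonneg {q : ℝ} (hq₀ : 0 ≤ q) (hq₁ : q ≤ 1) (c : Bool) : 0 ≤ coinWeight q c := by
  cases c <;> simp [coinWeight, hq₀, hq₁]

lemma sum_prod_bool {T : ℕ} (β : Bool → ℝ) :
    ∑ C : Fin T → Bool, ∏ t, β (C t) = (β true + β false) ^ T := by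
  have := Finset.prod_univ_sum (fun _ : Fin T => (Finset.univ : Finset Bool)) (fun _ c => β c)
  rw [Fintype.piFinset_univ] at this
  rw [← this]
  simp

lemma sum_prod_coinWeight {T : ℕ} (q : ℝ) :
    ∑ C : Fin T → Bool, ∏ t, coinWeight q (C t) = 1 := by
  rw [sum_prod_bool]; simp [coinWeight]

/-- Markov's inequality for `2 ^ (number of marked rounds)`, whose expectation is `(1 + q) ^ T`. -/
lemma sum_coinWeight_tail_le {T : ℕ} {q : ℝ} (hq₀ : 0 ≤ q) (hq₁ : q ≤ 1) (cap : ℕ) :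
    ∑ C : Fin T → Bool, (∏ t, coinWeight q (C t)) *
      (if (Finset.univ.filter fun t => C t = true).card ≤ cap then 0 else 1) ≤
        (1 + q) ^ T / 2 ^ (cap + 1) := by
  rw [le_div_iff₀ (by positivity), Finset.sum_mul]
  have h : (1 + q) ^ T = ∑ C : Fin T → Bool, ∏ t, (coinWeight q (C t) * if C t then 2 else 1) := by
    rw [sum_prod_bool fun c => coinWeight q c * if c then 2 else 1]
    congr 1
    simp [coinWeight]; ring
  rw [h]
  refine Finset.sum_le_sum fun C _ => ?_
  rw [Finset.prod_mul_distrib, mul_assoc]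
  refine mul_le_mul_of_nonneg_left ?_
    (Finset.prod_nonneg fun t _ => coinWeight_nonneg hq₀ hq₁ _)
  rw [Finset.prod_ite, Finset.prod_const, Finset.prod_const_one, mul_one]
  split_ifs with hC
  · simp
  · rw [one_mul]
    exact pow_le_pow_right₀ (by norm_num) (by omega)

/-- Laziness is free in expectation: the marginals of the averaged chain are the multiplicative
weights distributions. The correlations between rounds do not matter for a sum of losses on a fixed
stream. -/
lemma sum_lazyChain_loss [Nonempty E] {q δ : ℝ} (hq : 0 < q) (hδ : δ < 1) (L : ℕ → E → Bool)
    (T : ℕ) :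
    ∑ i, (Fintype.card E : ℝ)⁻¹ * ∑ C : Fin T → Bool, (∏ t, coinWeight q (C t)) *
      ∑ σ, chainWeight (fun t : Fin T => lazyKernel q δ (C t) (L t) (lossCount L (t + 1))) i σ *
        ∑ t : Fin T, ((L (t + 1) (σ t)).toNat : ℝ) =
      ∑ t ∈ Finset.range T, mwLoss δ L (t + 1) := by
  set κ : Fin T → E → E → ℝ := fun t i j =>
    ∑ c, coinWeight q c * lazyKernel q δ c (L t) (lossCount L (t + 1)) i j with hκ
  have hκ₁ : ∀ t i, ∑ j, κ t i j = 1 := by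
    intro t i
    simp only [hκ]
    rw [Finset.sum_comm]
    simp only [← Finset.mul_sum, sum_lazyKernel hδ]
    simp [coinWeight]
  have hm : ∀ (t : Fin T) j, ∑ i, expWeight δ (lossCount L t) i * κ t i j =
      expWeight δ (lossCount L (t + 1)) j := by
    intro t j
    rw [← sum_expWeight_mul_lazyKernel hq hδ L t j]
    simp [hκ, coinWeight]
  have hC : ∀ i, ∑ C : Fin T → Bool, (∏ t, coinWeight q (C t)) *
      ∑ σ, chainWeight (fun t : Fin T => lazyKernel q δ (C t) (L t) (lossCount L (t + 1))) i σ *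
        ∑ t : Fin T, ((L (t + 1) (σ t)).toNat : ℝ) =
      ∑ t : Fin T, ∑ σ, chainWeight κ i σ * ((L (t + 1) (σ t)).toNat : ℝ) := by
    intro i
    simp only [Finset.mul_sum, ← mul_assoc]
    rw [Finset.sum_comm, Finset.sum_comm (s := Finset.univ (α := Fin T))]
    refine Finset.sum_congr rfl fun σ _ => ?_
    rw [Finset.sum_comm]
    refine Finset.sum_congr rfl fun t _ => ?_
    rw [← Finset.sum_mul]
    congr 1
    exact sum_prod_mul_chainWeight (coinWeight q)
      (fun t c => lazyKernel q δ c (L t) (lossCount L (t + 1))) i σ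
  simp only [hC]
  rw [← Fin.sum_univ_eq_sum_range]
  simp only [Finset.mul_sum]
  rw [Finset.sum_comm]
  refine Finset.sum_congr rfl fun t _ => ?_
  rw [mwLoss, ← sum_chainWeight_apply κ hκ₁ (fun t => expWeight δ (lossCount L t)) hm
    (fun j => ((L (t + 1) j).toNat : ℝ)) t]
  refine Finset.sum_congr rfl fun i _ => ?_
  have h0 : lossCount L 0 = fun _ => 0 := by funext j; simp [lossCount]
  rw [h0, expWeight_zero, Finset.mul_sum]

end LazyChain

/-! ### The learner -/

section LazyLearner

variable {X 𝒱 : Type u} {E : Type} {T : ℕ}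

/-- Which experts err in which rounds. -/
def lossMatrix {n : ℕ} (hyp : E → Hypothesis X) (past : Fin n → X × Bool) : Fin n → E → Bool :=
  fun s e => hyp e (past s).1 != (past s).2

/-- The losses as a sequence, delayed by one round, and zero before and after the given rounds. -/
def delayedLoss {n : ℕ} (A : Fin n → E → Bool) : ℕ → E → Bool
  | 0 => fun _ => false
  | s + 1 => fun e => if h : s < n then A ⟨s, h⟩ e else false

/-- The input of a step of the lazy chain: a coin, the latest losses, and the loss counts. -/
abbrev LazyInput (T : ℕ) (E : Type) : Type := Bool × (E → Bool) × (E → Fin (T + 1))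

/-- The inputs of the lazy chain for the losses `A` and the coins `C`. -/
def lazyInput {n : ℕ} (A : Fin n → E → Bool) (C : Fin T → Bool) (t : Fin T) : LazyInput T E :=
  (C t, delayedLoss A t, fun e => Fin.ofNat (T + 1) (lossCount (delayedLoss A) (t + 1) e))

/-- The transition probabilities of the lazy chain in terms of its input. -/
noncomputable def inputKernel [Fintype E] [DecidableEq E] (q δ : ℝ) (r : LazyInput T E) :
    E → E → ℝ :=
  lazyKernel q δ r.1 r.2.1 fun e => (r.2.2 e).val

lemma inputKernel_lazyInput [Fintype E] [DecidableEq E] {n : ℕ} (q δ : ℝ) (A : Fin n → E → Bool)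
    (C : Fin T → Bool) (t : Fin T) :
    inputKernel q δ (lazyInput A C t) =
      lazyKernel q δ (C t) (delayedLoss A t) (lossCount (delayedLoss A) (t + 1)) := by
  unfold inputKernel lazyInput
  congr 1
  funext e
  have := lossCount_le (delayedLoss A) (t + 1) e
  simp only [Fin.val_ofNat]
  exact Nat.mod_eq_of_lt (by omega)

/-- Because of the delay, steps up to `t` read only examples before round `t`; hence the learner is
causal. -/
lemma lazyInput_prefix (hyp : E → Hypothesis X) (S : DataStream X T) (C : Fin T → Bool)
    {t s : Fin T} (hs : s ≤ t) :
    lazyInput (lossMatrix hyp fun i : Fin t.val => S ⟨i.val, i.isLt.trans t.isLt⟩) C s =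
      lazyInput (lossMatrix hyp S) C s := by
  have h : ∀ m ≤ t.val, delayedLoss (lossMatrix hyp
      fun i : Fin t.val => S ⟨i.val, i.isLt.trans t.isLt⟩) m = delayedLoss (lossMatrix hyp S) m := by
    intro m hm
    cases m with
    | zero => rfl
    | succ m =>
      have h1 : m < t.val := hm
      have h2 : m < T := h1.trans t.isLt
      funext e
      simp [delayedLoss, h1, h2, lossMatrix]
  have hs' : s.val ≤ t.val := hs
  unfold lazyInput
  rw [h _ hs']
  congr 2
  funext e
  congr 1
  refine Finset.sum_congr rfl fun m hm => ?_
  rw [h m (by have := Finset.mem_range.1 hm; omega)]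

lemma mistakes_eq_sum (hyp : E → Hypothesis X) (S : DataStream X T) (σ : Fin T → E) :
    mistakes (fun t => hyp (σ t)) S =
      ∑ t : Fin T, (delayedLoss (lossMatrix hyp S) (t + 1) (σ t)).toNat := by
  unfold mistakes
  refine Finset.sum_congr rfl fun t _ => ?_
  simp only [delayedLoss, lossMatrix, t.isLt, dif_pos, Fin.eta]
  by_cases h : hyp (σ t) (S t).1 = (S t).2
  · simp [h]
  · rw [if_pos h, bne_iff_ne.2 h, Bool.toNat_true]

/-- The expert that the learner follows in round `t`, given the path of the lazy chain. -/
def chosenExpert (cap : ℕ) (i : E) (C : Fin T → Bool) (σ : Fin T → E) : Fin T → E :=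
  if (Finset.univ.filter fun t => C t = true).card ≤ cap then σ else fun _ => i

/-- The hypotheses that the learner outputs, given its internal randomness. -/
def lazyOutput (hyp : 𝒱 → E → Hypothesis X) (cap : ℕ) (S : DataStream X T) (v : 𝒱)
    (b : E × (Fin T → Bool)) (ω : Fin T → LazyInput T E × E → E) : Fin T → Hypothesis X :=
  fun t => hyp v (chosenExpert cap b.1 b.2
    (chainPath (lazyInput (lossMatrix (hyp v) S) b.2) b.1 ω) t)

lemma lazyOutput_def (hyp : 𝒱 → E → Hypothesis X) (cap : ℕ) (S : DataStream X T) (v : 𝒱) (b : E × (Fin T → Bool))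
    (ω : Fin T → LazyInput T E × E → E) :
    lazyOutput hyp cap S v b ω = fun t => hyp v (chosenExpert cap b.1 b.2
      (chainPath (lazyInput (lossMatrix (hyp v) S) b.2) b.1 ω) t) :=
  rfl

variable [Fintype E] [DecidableEq E] [MeasurableSpace E] [MeasurableSingletonClass E]
  [MeasurableSpace 𝒱]

/-- The lazy multiplicative weights learner. The class of experts `hyp v` is drawn according to
`P`, the starting expert and the coins according to `Q`. If there are more than `cap` potential
switching times, the starting expert is never replaced. -/
noncomputable def lazyLearner (P : Measure 𝒱) [IsProbabilityMeasure P] (hyp : 𝒱 → E → Hypothesis X)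
    (hhyp : ∀ e, Measurable fun v => hyp v e) (Q : PMF (E × (Fin T → Bool))) (cap : ℕ)
    (K : LazyInput T E → E → PMF E) : OnlineLearner X T where
  Seed := 𝒱 × (E × (Fin T → Bool)) × (Fin T → LazyInput T E × E → E)
  seedSpace := inferInstance
  law := P.prod (Q.toMeasure.prod (chainLaw T K))
  law_prob := inferInstance
  predict t past ω := hyp ω.1
    (if (Finset.univ.filter fun t => ω.2.1.2 t = true).card ≤ cap then
      chainPath (lazyInput (lossMatrix (hyp ω.1) past) ω.2.1.2) ω.2.1.1 ω.2.2 t else ω.2.1.1)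
  measurable_predict t past := by
    -- All parts of the seed except the class `v` range over finite sets, so only measurability in
    -- `v` is at stake.
    refine measurable_from_prod_countable_left fun ω => ?_
    have h1 : Measurable fun v => lossMatrix (hyp v) past := by
      refine measurable_pi_lambda _ fun s => measurable_pi_lambda _ fun e => ?_
      exact (Measurable.of_discrete (f := fun b : Bool => b != (past s).2)).comp
        ((measurable_pi_apply _).comp (hhyp e))
    have h2 : Measurable fun v =>
        (if (Finset.univ.filter fun t => ω.1.2 t = true).card ≤ cap then
          chainPath (lazyInput (lossMatrix (hyp v) past) ω.1.2) ω.1.1 ω.2 t else ω.1.1) :=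
      (Measurable.of_discrete (f := fun A : Fin t.val → E → Bool =>
        (if (Finset.univ.filter fun t => ω.1.2 t = true).card ≤ cap then
          chainPath (lazyInput A ω.1.2) ω.1.1 ω.2 t else ω.1.1))).comp h1
    exact (measurable_from_prod_countable_left (f := fun p : 𝒱 × E => hyp p.1 p.2) hhyp).comp
      (measurable_id.prodMk h2)

variable {P : Measure 𝒱} [IsProbabilityMeasure P] {hyp : 𝒱 → E → Hypothesis X}
  {hhyp : ∀ e, Measurable fun v => hyp v e} {Q : PMF (E × (Fin T → Bool))} {cap : ℕ}
  {K : LazyInput T E → E → PMF E}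

lemma lazyLearner_outputs (S : DataStream X T)
    (ω : 𝒱 × (E × (Fin T → Bool)) × (Fin T → LazyInput T E × E → E)) :
    (lazyLearner P hyp hhyp Q cap K).outputs S ω =
      lazyOutput hyp cap S ω.1 ω.2.1 ω.2.2 := by
  funext t
  change hyp ω.1 _ = _
  congr 1
  unfold chosenExpert
  split_ifs
  · exact chainState_congr _ _ fun s hs =>
      lazyInput_prefix _ _ _ (Fin.le_def.2 (Nat.lt_succ_iff.1 hs))
  · rfl

lemma OnlineLearner.measurable_outputs (A : OnlineLearner X T) (S : DataStream X T) :
    Measurable (A.outputs S) :=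
  measurable_pi_lambda _ fun t => A.measurable_predict t _

/-- The lazy learner is differentially private. -/
lemma lazyLearner_isDP {q δ x ε : ℝ} (hδ₀ : 0 ≤ δ) (hδ : δ < 1) (hx : x = (1 - q / 2) * δ / q)
    (hx₀ : 0 ≤ x) (hx₁ : x ≤ 1 / 4)
    (hK : ∀ r i j, K r i j = ENNReal.ofReal (inputKernel q δ r i j)) (hε : 0 ≤ ε)
    (hcap : (((1 - δ)⁻¹) ^ 2) ^ cap * (1 - 2 * x)⁻¹ ≤ Real.exp ε) :
    (lazyLearner P hyp hhyp Q cap K).IsDP ε := by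
  rintro S₁ S₂ ⟨d, hd⟩ O hO
  set A := lazyLearner P hyp hhyp Q cap K with hA
  have hexp : 1 ≤ ENNReal.ofReal (Real.exp ε) := by
    rw [ENNReal.one_le_ofReal]; exact Real.one_le_exp hε
  have hset : ∀ S : DataStream X T, {ω | A.outputs S ω ∈ O} =
      {ω | lazyOutput hyp cap S ω.1 ω.2.1 ω.2.2 ∈ O} := fun S =>
    Set.ext fun ω => iff_of_eq (congrArg (· ∈ O) (lazyLearner_outputs S ω))
  have hmeas : ∀ S : DataStream X T,
      MeasurableSet {ω : 𝒱 × (E × (Fin T → Bool)) × (Fin T → LazyInput T E × E → E) |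
        lazyOutput hyp cap S ω.1 ω.2.1 ω.2.2 ∈ O} := fun S => by
    have h := A.measurable_outputs S hO
    exact hset S ▸ h
  -- The class, the starting expert and the coins do not depend on the stream, so privacy
  -- conditional on them suffices.
  have hfib : ∀ (v : 𝒱) (b : E × (Fin T → Bool)),
      chainLaw T K {ω | lazyOutput hyp cap S₁ v b ω ∈ O} ≤
        ENNReal.ofReal (Real.exp ε) * chainLaw T K {ω | lazyOutput hyp cap S₂ v b ω ∈ O} := by
    rintro v ⟨i, C⟩
    simp only [lazyOutput_def]
    by_cases hC : (Finset.univ.filter fun t => C t = true).card ≤ cap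
    swap
    · simp only [chosenExpert, hC, if_false]
      exact le_mul_of_one_le_left zero_le hexp
    simp only [chosenExpert, hC, if_true]
    set L₁ := delayedLoss (lossMatrix (hyp v) S₁) with hL₁
    set L₂ := delayedLoss (lossMatrix (hyp v) S₂) with hL₂
    have hL : ∀ s, s ≠ d.val + 1 → L₁ s = L₂ s := by
      intro s hs
      cases s with
      | zero => rfl
      | succ s =>
        funext e
        simp only [hL₁, hL₂, delayedLoss, lossMatrix]
        split_ifs with h
        · rw [hd ⟨s, h⟩ (by simpa [Fin.ext_iff] using hs)]
        · rfl
    have hG : 1 ≤ ((1 - δ)⁻¹) ^ 2 := by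
      apply one_le_pow₀
      rw [one_le_inv₀ (by linarith)]; linarith
    have hR : 1 ≤ (1 - 2 * x)⁻¹ := by
      rw [one_le_inv₀ (by linarith)]; linarith
    have h₀ : ∀ (r : LazyInput T E) i j, 0 ≤ inputKernel q δ r i j := fun r i j =>
      have : Nonempty E := ⟨i⟩
      lazyKernel_nonneg hδ hx hx₀ hx₁ _ _ _ _ _
    refine chainLaw_path_mem_le (κ := inputKernel q δ) h₀ hK i
      (c := fun t => (if C t then ((1 - δ)⁻¹) ^ 2 else 1) *
        (if L₁ t = L₂ t then 1 else (1 - 2 * x)⁻¹)) ?_ (le_trans ?_ hcap) ?_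
      {σ | (fun t => hyp v (σ t)) ∈ O}
    · intro t
      split_ifs <;> positivity
    · rw [Finset.prod_mul_distrib, Finset.prod_ite, Finset.prod_const, Finset.prod_const_one,
        mul_one, Finset.prod_ite, Finset.prod_const_one, Finset.prod_const, one_mul]
      -- The altered example `d` is the latest one only in step `d + 1`.
      have h1 : (Finset.univ.filter fun t : Fin T => ¬ L₁ t = L₂ t).card ≤ 1 := by
        refine Finset.card_le_one.2 fun a ha b hb => ?_
        simp only [Finset.mem_filter, Finset.mem_univ, true_and] at ha hb
        have ha' := not_imp_comm.1 (hL a) ha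
        have hb' := not_imp_comm.1 (hL b) hb
        exact Fin.ext (ha'.trans hb'.symm)
      refine mul_le_mul (pow_le_pow_right₀ hG hC) ?_ (by positivity) (by positivity)
      exact (pow_le_pow_right₀ hR h1).trans_eq (pow_one _)
    · intro t i j
      have : Nonempty E := ⟨i⟩
      rw [inputKernel_lazyInput, inputKernel_lazyInput]
      exact lazyKernel_le_mul hδ₀ hδ hx hx₀ hx₁ _ (lossCount_le_add_one hL _)
        (lossCount_le_add_one (fun s hs => (hL s hs).symm) _) i j
  have hlaw : ∀ S : DataStream X T, A.law {ω | A.outputs S ω ∈ O} =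
      ∫⁻ v, ∫⁻ b, chainLaw T K {ω | lazyOutput hyp cap S v b ω ∈ O} ∂Q.toMeasure ∂P := by
    intro S
    rw [hset S]
    refine (Measure.prod_apply (hmeas S)).trans (lintegral_congr fun v => ?_)
    exact Measure.prod_apply (measurable_prodMk_left (hmeas S))
  rw [hlaw, hlaw, ← lintegral_const_mul' _ _ ENNReal.ofReal_ne_top]
  refine lintegral_mono fun v => ?_
  rw [← lintegral_const_mul' _ _ ENNReal.ofReal_ne_top]
  exact lintegral_mono fun b => hfib v b

/-! ### Expected mistakes of the lazy learner -/

lemma mistakes_le (h : Fin T → Hypothesis X) (S : DataStream X T) : mistakes h S ≤ T := by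
  unfold mistakes
  calc _ ≤ ∑ t : Fin T, 1 := Finset.sum_le_sum fun t _ => by split_ifs <;> simp
    _ = T := by simp

lemma integrable_mistakes (A : OnlineLearner X T) (S : DataStream X T) :
    Integrable (fun ω => (mistakes (A.outputs S ω) S : ℝ)) A.law := by
  refine Integrable.of_bound (C := T) (Measurable.aestronglyMeasurable ?_)
    (Filter.Eventually.of_forall fun ω => ?_)
  · unfold mistakes
    push_cast
    refine Finset.measurable_sum _ fun t _ => ?_
    exact (Measurable.of_discrete (f := fun b : Bool => if b ≠ (S t).2 then (1 : ℝ) else 0)).comp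
      ((measurable_pi_apply _).comp (A.measurable_predict t _))
  · rw [Real.norm_natCast]
    exact_mod_cast mistakes_le _ _

/-- The expected number of mistakes of the lazy learner. -/
lemma integral_mistakes_lazyLearner_le {q δ x : ℝ} (hq₀ : 0 < q) (hq₁ : q ≤ 1) (hδ₀ : 0 < δ)
    (hδ : δ ≤ 1 / 2) (hx : x = (1 - q / 2) * δ / q) (hx₀ : 0 ≤ x) (hx₁ : x ≤ 1 / 4)
    (hK : ∀ r i j, K r i j = ENNReal.ofReal (inputKernel q δ r i j))
    (hQ : ∀ i C, Q (i, C) =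
      ENNReal.ofReal ((Fintype.card E : ℝ)⁻¹ * ∏ t, coinWeight q (C t)))
    (S : DataStream X T) {g : 𝒱 → ℝ} (hg : Integrable g P)
    (hgS : ∀ v, ∃ e, (mistakes (fun _ => hyp v e) S : ℝ) ≤ g v) :
    ∫ ω, (mistakes ((lazyLearner P hyp hhyp Q cap K).outputs S ω) S : ℝ)
        ∂(lazyLearner P hyp hhyp Q cap K).law ≤
      Real.log (Fintype.card E) / δ + 2 * δ * T + T * ((1 + q) ^ T / 2 ^ (cap + 1)) +
        ∫ v, g v ∂P := by
  set A := lazyLearner P hyp hhyp Q cap K with hA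
  set B := Real.log (Fintype.card E) / δ + 2 * δ * T + T * ((1 + q) ^ T / 2 ^ (cap + 1)) with hB
  have hint : Integrable (fun ω => (mistakes (A.outputs S ω) S : ℝ))
      (P.prod (Q.toMeasure.prod (chainLaw T K))) := integrable_mistakes A S
  have hout : (fun ω => (mistakes (A.outputs S ω) S : ℝ)) =
      fun ω => (mistakes (lazyOutput hyp cap S ω.1 ω.2.1 ω.2.2) S : ℝ) :=
    funext fun ω => congrArg (fun h => (mistakes h S : ℝ)) (lazyLearner_outputs S ω)
  rw [hout] at hint ⊢
  have hfib : ∀ v, ∫ ω, (mistakes (lazyOutput hyp cap S v ω.1 ω.2) S : ℝ) ∂(Q.toMeasure.prod (chainLaw T K)) ≤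
      B + g v := by
    intro v
    obtain ⟨e, he⟩ := hgS v
    have : Nonempty E := ⟨e⟩
    have h₀ : ∀ (r : LazyInput T E) i j, 0 ≤ inputKernel q δ r i j := fun r i j =>
      lazyKernel_nonneg (by linarith) hx hx₀ hx₁ _ _ _ _ _
    set L := delayedLoss (lossMatrix (hyp v) S) with hL
    set W : (Fin T → Bool) → E → (Fin T → E) → ℝ := fun C i σ =>
      chainWeight (fun t : Fin T => lazyKernel q δ (C t) (L t) (lossCount L (t + 1))) i σ with hW
    have hW₀ : ∀ C i σ, 0 ≤ W C i σ := fun C i σ => Finset.prod_nonneg fun t _ =>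
      lazyKernel_nonneg (by linarith) hx hx₀ hx₁ _ _ _ _ _
    have hW₁ : ∀ C i, ∑ σ, W C i σ = 1 := fun C i =>
      sum_chainWeight _ (fun t i => sum_lazyKernel (by linarith) _ _ _ _) i
    have hE : (0 : ℝ) < Fintype.card E := by exact_mod_cast Fintype.card_pos
    have hβ : ∀ C : Fin T → Bool, 0 ≤ ∏ t, coinWeight q (C t) := fun C =>
      Finset.prod_nonneg fun t _ => coinWeight_nonneg hq₀.le hq₁ _
    have hpt : ∀ C i σ, (mistakes (fun t => hyp v (chosenExpert cap i C σ t)) S : ℝ) ≤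
        ∑ t : Fin T, ((L (t + 1) (σ t)).toNat : ℝ) + T *
          (if (Finset.univ.filter fun t => C t = true).card ≤ cap then 0 else 1) := by
      intro C i σ
      by_cases hC : (Finset.univ.filter fun t => C t = true).card ≤ cap
      · simp only [chosenExpert, hC, if_true, mistakes_eq_sum]
        simp [hL]
      · simp only [hC, if_false, mul_one]
        have h1 : (mistakes (fun t => hyp v (chosenExpert cap i C σ t)) S : ℝ) ≤ T := by
          exact_mod_cast mistakes_le _ _
        have h2 : (0 : ℝ) ≤ ∑ t : Fin T, ((L (t + 1) (σ t)).toNat : ℝ) := by positivity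
        linarith
    have hinner : ∀ b : E × (Fin T → Bool),
        ∫ ω, (mistakes (lazyOutput hyp cap S v b ω) S : ℝ) ∂chainLaw T K ≤
          (∑ σ, W b.2 b.1 σ * ∑ t : Fin T, ((L (t + 1) (σ t)).toNat : ℝ)) + T *
          (if (Finset.univ.filter fun t => b.2 t = true).card ≤ cap then 0 else 1) := by
      rintro ⟨i, C⟩
      simp only [lazyOutput_def]
      rw [integral_chainPath (κ := inputKernel q δ) h₀ hK _ i
        (fun σ => (mistakes (fun t => hyp v (chosenExpert cap i C σ t)) S : ℝ))]
      simp only [inputKernel_lazyInput]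
      calc _ ≤ ∑ σ, W C i σ * (∑ t : Fin T, ((L (t + 1) (σ t)).toNat : ℝ) + T *
            (if (Finset.univ.filter fun t => C t = true).card ≤ cap then 0 else 1)) :=
            Finset.sum_le_sum fun σ _ => mul_le_mul_of_nonneg_left (hpt C i σ) (hW₀ C i σ)
        _ = _ := by
            simp only [mul_add, Finset.sum_add_distrib, ← Finset.sum_mul, hW₁, one_mul]
    have hprod : ∫ ω, (mistakes (lazyOutput hyp cap S v ω.1 ω.2) S : ℝ) ∂(Q.toMeasure.prod (chainLaw T K)) =
        ∫ b, ∫ ω, (mistakes (lazyOutput hyp cap S v b ω) S : ℝ) ∂chainLaw T K ∂Q.toMeasure :=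
      integral_prod _ Integrable.of_finite
    rw [hprod, PMF.integral_eq_sum, Fintype.sum_prod_type]
    have hQr : ∀ i C, (Q (i, C)).toReal =
        (Fintype.card E : ℝ)⁻¹ * ∏ t, coinWeight q (C t) := by
      intro i C
      rw [hQ, ENNReal.toReal_ofReal (mul_nonneg (by positivity) (hβ C))]
    have hmw : ∑ t ∈ Finset.range T, mwLoss δ L (t + 1) ≤
        Real.log (Fintype.card E) / δ + 2 * δ * T + g v := by
      have h1 := sum_mwLoss_le hδ₀ hδ L (T + 1) e
      -- The dummy round created by the delay costs nothing, so `T + 1` delayed rounds account for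
      -- the `T` real ones.
      have h2 : mwLoss δ L 0 = 0 := by simp [mwLoss, hL, delayedLoss]
      have h3 : lossCount L (T + 1) e = mistakes (fun _ => hyp v e) S := by
        rw [mistakes_eq_sum (hyp v) S fun _ => e, lossCount, Finset.sum_range_succ',
          ← Fin.sum_univ_eq_sum_range (fun t => (L (t + 1) e).toNat)]
        simp [hL, delayedLoss]
      have h4 : (mistakes (fun _ => hyp v e) S : ℝ) ≤ T := by exact_mod_cast mistakes_le _ _
      rw [Finset.sum_range_succ', h2, add_zero, h3] at h1
      have h5 : 2 * δ * (mistakes (fun _ => hyp v e) S : ℝ) ≤ 2 * δ * T := by gcongr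
      linarith
    calc _ ≤ ∑ i, ∑ C, ((Fintype.card E : ℝ)⁻¹ * ∏ t, coinWeight q (C t)) *
          ((∑ σ, W C i σ * ∑ t : Fin T, ((L (t + 1) (σ t)).toNat : ℝ)) + T *
          (if (Finset.univ.filter fun t => C t = true).card ≤ cap then 0 else 1)) := by
          refine Finset.sum_le_sum fun i _ => Finset.sum_le_sum fun C _ => ?_
          rw [hQr, smul_eq_mul]
          exact mul_le_mul_of_nonneg_left (hinner (i, C)) (mul_nonneg (by positivity) (hβ C))
      _ = (∑ i, (Fintype.card E : ℝ)⁻¹ * ∑ C : Fin T → Bool, (∏ t, coinWeight q (C t)) *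
            ∑ σ, W C i σ * ∑ t : Fin T, ((L (t + 1) (σ t)).toNat : ℝ)) +
          ∑ i : E, (Fintype.card E : ℝ)⁻¹ * (T * ∑ C : Fin T → Bool, (∏ t, coinWeight q (C t)) *
            (if (Finset.univ.filter fun t => C t = true).card ≤ cap then 0 else 1)) := by
          rw [← Finset.sum_add_distrib]
          refine Finset.sum_congr rfl fun i _ => ?_
          rw [← mul_add, Finset.mul_sum, ← Finset.sum_add_distrib, Finset.mul_sum]
          refine Finset.sum_congr rfl fun C _ => ?_
          ring
      _ ≤ (Real.log (Fintype.card E) / δ + 2 * δ * T + g v) +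
          T * ((1 + q) ^ T / 2 ^ (cap + 1)) := by
          rw [sum_lazyChain_loss hq₀ (by linarith), Finset.sum_const, Finset.card_univ,
            nsmul_eq_mul, ← mul_assoc, mul_inv_cancel₀ hE.ne', one_mul]
          gcongr
          exact sum_coinWeight_tail_le hq₀.le hq₁ cap
      _ = B + g v := by rw [hB]; ring
  calc _ = ∫ v, ∫ ω, (mistakes (lazyOutput hyp cap S v ω.1 ω.2) S : ℝ) ∂(Q.toMeasure.prod (chainLaw T K)) ∂P :=
        integral_prod _ hint
    _ ≤ ∫ v, (B + g v) ∂P :=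
        integral_mono hint.integral_prod_left ((integrable_const B).add hg) hfib
    _ = B + ∫ v, g v ∂P := by
        rw [integral_add (integrable_const B) hg]; simp

end LazyLearner

/-! ### Choice of the parameters -/

lemma inv_one_sub_le_exp {y : ℝ} (hy₀ : 0 ≤ y) (hy : y ≤ 1 / 2) :
    (1 - y)⁻¹ ≤ Real.exp (2 * y) := by
  have h := Real.add_one_le_exp (2 * y)
  refine le_trans ?_ h
  rw [inv_le_iff_one_le_mul₀ (by linarith)]
  nlinarith

/-- Private prediction with the advice of finitely many random experts. -/
lemma exists_private_experts {X 𝒱 : Type u} {E : Type} [Fintype E] [DecidableEq E] [Nonempty E]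
    [MeasurableSpace E] [MeasurableSingletonClass E] [MeasurableSpace 𝒱] (P : Measure 𝒱)
    [IsProbabilityMeasure P] (hyp : 𝒱 → E → Hypothesis X)
    (hhyp : ∀ e, Measurable fun v => hyp v e) {ε : ℝ} (hε : 0 < ε) {T : ℕ} (hT : 1 ≤ T) :
    ∃ A : OnlineLearner X T, A.IsDP ε ∧ ∀ (S : DataStream X T) (g : 𝒱 → ℝ), Integrable g P →
      (∀ v, ∃ e, (mistakes (fun _ => hyp v e) S : ℝ) ≤ g v) →
      ∫ ω, (mistakes (A.outputs S ω) S : ℝ) ∂A.law ≤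
        20 * (Real.sqrt T * Real.log (Fintype.card E) / min ε 1) + 2 * Real.sqrt T +
          ∫ v, g v ∂P := by
  set s := Real.sqrt T with hs
  set e := min ε 1 with he
  have he₀ : 0 < e := lt_min hε one_pos
  have he₁ : e ≤ 1 := min_le_right _ _
  have hTs : s * s = T := Real.mul_self_sqrt (Nat.cast_nonneg T)
  have hs₁ : 1 ≤ s := Real.one_le_sqrt.2 (by exact_mod_cast hT)
  have hs₀ : 0 < s := by linarith
  -- About `s = √T` rounds are marked on average. With `δ = e / (20 * s)` and `cap ≤ 4 * s`,
  -- resampling costs at most `4 * δ * cap ≤ 16 * e / 20` in the privacy exponent, and the changed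
  -- switching rate at most `4 * x ≤ 4 * e / 20`; together `e`.
  set q := 1 / s with hq
  have hq₀ : 0 < q := by positivity
  have hq₁ : q ≤ 1 := by rw [hq, div_le_one hs₀]; exact hs₁
  set δ := e / (20 * s) with hδ
  have hδ₀ : 0 < δ := by positivity
  have hδs : δ * s = e / 20 := by rw [hδ]; field_simp
  have hδ₁ : δ ≤ 1 / 2 := by nlinarith
  set x := (1 - q / 2) * δ / q with hx
  have hxe : x = (1 - q / 2) * (e / 20) := by
    rw [hx, ← hδs, hq]; field_simp
  have hx₀ : 0 ≤ x := by rw [hxe]; exact mul_nonneg (by linarith) (by linarith)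
  have hxle : x ≤ e / 20 := by
    rw [hxe]; exact mul_le_of_le_one_left (by linarith) (by linarith)
  have hx₁ : x ≤ 1 / 4 := by linarith
  set cap := ⌊4 * s⌋₊ with hcap
  have hcap_le : (cap : ℝ) ≤ 4 * s := Nat.floor_le (by positivity)
  have hcap_lt : 4 * s < cap + 1 := Nat.lt_floor_add_one _
  choose K hK using fun (r : LazyInput T E) (i : E) =>
    exists_pmf_eq_ofReal (inputKernel q δ r i)
      (fun j => lazyKernel_nonneg (by linarith) hx hx₀ hx₁ _ _ _ _ _)
      (sum_lazyKernel (by linarith) _ _ _ _)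
  obtain ⟨Q, hQ⟩ := exists_pmf_eq_ofReal
    (fun b : E × (Fin T → Bool) => (Fintype.card E : ℝ)⁻¹ * ∏ t, coinWeight q (b.2 t))
    (fun b => mul_nonneg (by positivity)
      (Finset.prod_nonneg fun t _ => coinWeight_nonneg hq₀.le hq₁ _)) (by
      rw [Fintype.sum_prod_type]
      simp only [← Finset.mul_sum, sum_prod_coinWeight, mul_one, Finset.sum_const,
        Finset.card_univ, nsmul_eq_mul]
      exact mul_inv_cancel₀ (by exact_mod_cast Fintype.card_ne_zero))
  refine ⟨lazyLearner P hyp hhyp Q cap K,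
    lazyLearner_isDP hδ₀.le (by linarith) hx hx₀ hx₁ hK hε.le ?_, fun S g hg hgS => ?_⟩
  · have h1 : ((1 - δ)⁻¹ ^ 2) ^ cap ≤ Real.exp (16 * (e / 20)) := by
      rw [← pow_mul]
      calc (1 - δ)⁻¹ ^ (2 * cap) ≤ Real.exp (2 * δ) ^ (2 * cap) :=
            pow_le_pow_left₀ (inv_nonneg.2 (by linarith)) (inv_one_sub_le_exp hδ₀.le hδ₁) _
        _ = Real.exp (4 * δ * cap) := by
            rw [← Real.exp_nat_mul]; congr 1; push_cast; ring
        _ ≤ _ := by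
            apply Real.exp_le_exp.2
            rw [← hδs]
            nlinarith
    have h2 : (1 - 2 * x)⁻¹ ≤ Real.exp (4 * (e / 20)) :=
      (inv_one_sub_le_exp (by linarith) (by linarith)).trans (Real.exp_le_exp.2 (by linarith))
    calc _ ≤ Real.exp (16 * (e / 20)) * Real.exp (4 * (e / 20)) :=
          mul_le_mul h1 h2 (inv_nonneg.2 (by linarith)) (Real.exp_pos _).le
      _ = Real.exp e := by rw [← Real.exp_add]; congr 1; ring
      _ ≤ Real.exp ε := Real.exp_le_exp.2 (min_le_left _ _)
  · have h := integral_mistakes_lazyLearner_le (hhyp := hhyp) (cap := cap) hq₀ hq₁ hδ₀ hδ₁ hx hx₀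
      hx₁ hK (fun i C => hQ (i, C)) S hg hgS
    refine h.trans (add_le_add_left ?_ _)
    have h1 : Real.log (Fintype.card E) / δ = 20 * (s * Real.log (Fintype.card E) / e) := by
      rw [hδ]; field_simp
    have h2 : 2 * δ * T ≤ s := by
      rw [← hTs]
      nlinarith
    have h3 : (1 + q) ^ T ≤ Real.exp s := by
      calc (1 + q) ^ T ≤ Real.exp q ^ T :=
            pow_le_pow_left₀ (by linarith) (by linarith [Real.add_one_le_exp q]) _
        _ = Real.exp s := by
            rw [← Real.exp_nat_mul, ← hTs, hq]; congr 1; field_simp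
    -- The cap `4 * s` is large enough since `4 * log 2 > 2`; one factor `exp s` absorbs `s`, so the
    -- overflow event costs at most `s` mistakes.
    have h4 : Real.exp s * s ≤ 2 ^ (cap + 1) := by
      calc Real.exp s * s ≤ Real.exp s * Real.exp s := by
            gcongr; linarith [Real.add_one_le_exp s]
        _ = Real.exp (2 * s) := by rw [← Real.exp_add]; congr 1; ring
        _ ≤ Real.exp ((cap + 1 : ℕ) * Real.log 2) := by
            apply Real.exp_le_exp.2
            push_cast
            nlinarith [Real.log_two_gt_d9]
        _ = 2 ^ (cap + 1) := by
            rw [Real.exp_nat_mul, Real.exp_log (by norm_num)]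
    have h5 : T * ((1 + q) ^ T / 2 ^ (cap + 1)) ≤ s := by
      rw [← mul_div_assoc, div_le_iff₀ (by positivity), ← hTs]
      calc s * s * (1 + q) ^ T ≤ s * s * Real.exp s := by gcongr
        _ = s * (Real.exp s * s) := by ring
        _ ≤ _ := by gcongr
    rw [h1]
    linarith

lemma mistakes_le_add {X : Type u} {T : ℕ} (h h' : Hypothesis X) (S : DataStream X T) :
    mistakes (fun _ => h') S ≤
      mistakes (fun _ => h) S + ∑ t, if h' (S t).1 ≠ h (S t).1 then 1 else 0 := by
  unfold mistakes
  rw [← Finset.sum_add_distrib]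
  refine Finset.sum_le_sum fun t _ => ?_
  by_cases h1 : h' (S t).1 = h (S t).1
  · simp [h1]
  · simp only [ne_eq, h1, not_false_eq_true, if_true]
    split_ifs <;> omega

/-- Private online learning from a probabilistic representation by classes of size `k`. -/
lemma exists_private_learner {X : Type u} {H : Set (Hypothesis X)} (hH : H.Nonempty) {k : ℕ}
    (hk : 1 ≤ k) (P : Measure (Fin k → Hypothesis X)) [IsProbabilityMeasure P]
    (hP : IsProbRep (1 / 4) (1 / 4) H P) {ε : ℝ} (hε : 0 < ε) {T : ℕ} (hT : 1 ≤ T) (n : ℕ)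
    (hn : 128 * Real.log T ≤ n) :
    ∃ A : OnlineLearner X T, A.IsDP ε ∧ ∀ S : DataStream X T,
      expectedRegret A H S ≤
        20 * (Real.sqrt T * (n * Real.log k) / min ε 1) + 2 * Real.sqrt T + 1 := by
  have hne : Nonempty (Fin k) := ⟨⟨0, hk⟩⟩
  obtain ⟨A, hA, hreg⟩ := exists_private_experts (Measure.pi fun _ : Fin n => P)
    (E := Fin n → Fin k) majority measurable_majority hε hT
  refine ⟨A, hA, fun S => ?_⟩
  have hHne : Nonempty H := hH.to_subtype
  obtain ⟨⟨h, hh⟩, hmin⟩ := Nat.sInf_mem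
    (Set.range_nonempty fun h : H => mistakes (fun _ => h.val) S)
  change mistakes (fun _ => h) S = ⨅ h : H, mistakes (fun _ => h.val) S at hmin
  set Φ : (Fin n → Fin k → Hypothesis X) → ℝ≥0∞ := fun V =>
    ⨅ f, boostPotential h (fun t => (S t).1) (fun _ => 1) V f with hΦ
  have hΦm : Measurable Φ := Measurable.iInf fun f => measurable_boostPotential _ _ _ f
  have hΦle : ∫⁻ V, Φ V ∂(Measure.pi fun _ : Fin n => P) ≤ 1 := by
    refine (lintegral_iInf_boostPotential_le hk hP hh _ n _ fun _ => ENNReal.one_ne_top).trans ?_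
    have hT₀ : (0 : ℝ) < T := by exact_mod_cast hT
    have hr : (127 / 128 : ℝ) ^ n * T ≤ 1 := by
      have h1 : (127 / 128 : ℝ) ^ n ≤ Real.exp (-Real.log T) := by
        calc (127 / 128 : ℝ) ^ n ≤ Real.exp (-(1 / 128)) ^ n := by
              gcongr
              linarith [Real.add_one_le_exp (-(1 / 128 : ℝ))]
          _ = Real.exp (n * -(1 / 128)) := (Real.exp_nat_mul _ _).symm
          _ ≤ _ := Real.exp_le_exp.2 (by linarith)
      rw [Real.exp_neg, Real.exp_log hT₀] at h1
      calc _ ≤ (T : ℝ)⁻¹ * T := by gcongr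
        _ = 1 := inv_mul_cancel₀ hT₀.ne'
    have he : (127 / 128 : ℝ≥0∞) ^ n * ∑ _t : Fin T, 1 =
        ENNReal.ofReal ((127 / 128 : ℝ) ^ n * T) := by
      rw [ENNReal.ofReal_mul (by positivity), ENNReal.ofReal_pow (by norm_num),
        ENNReal.ofReal_div_of_pos (by norm_num)]
      simp
    rw [he]
    exact ENNReal.ofReal_le_one.2 hr
  have hΦtop : ∫⁻ V, Φ V ∂(Measure.pi fun _ : Fin n => P) ≠ ∞ :=
    ne_top_of_le_ne_top ENNReal.one_ne_top hΦle
  have hΦint : Integrable (fun V => (Φ V).toReal) (Measure.pi fun _ : Fin n => P) :=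
    integrable_toReal_of_lintegral_ne_top hΦm.aemeasurable hΦtop
  have hΦI : ∫ V, (Φ V).toReal ∂(Measure.pi fun _ : Fin n => P) ≤ 1 := by
    rw [integral_toReal hΦm.aemeasurable (ae_lt_top hΦm hΦtop)]
    exact ENNReal.toReal_le_of_le_ofReal zero_le_one (by simpa using hΦle)
  have hfin : ∀ (V : Fin n → Fin k → Hypothesis X) f, boostPotential h (fun t => (S t).1) (fun _ => 1) V f ≠ ∞ := by
    intro V f
    unfold boostPotential
    refine ENNReal.sum_ne_top.2 fun t _ => ENNReal.mul_ne_top ENNReal.one_ne_top ?_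
    exact ENNReal.prod_ne_top fun r _ => boostFactor_ne_top _
  -- The best majority vote makes at most as many mistakes as `h` plus its disagreements with `h`,
  -- which the minimal potential `Φ` bounds.
  have hmain := hreg S (fun V => (mistakes (fun _ => h) S : ℝ) + (Φ V).toReal)
    ((integrable_const _).add hΦint) (by
      intro V
      obtain ⟨f, hf⟩ := exists_eq_ciInf_of_finite
        (f := fun f => boostPotential h (fun t => (S t).1) (fun _ => 1) V f)
      refine ⟨f, ?_⟩
      have h1 := mistakes_le_add h (majority V f) S
      have h2 := card_majority_ne_le h (fun t => (S t).1) V f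
      have h3 : ((∑ t, if majority V f (S t).1 ≠ h (S t).1 then 1 else 0 : ℕ) : ℝ) ≤
          (Φ V).toReal := by
        change _ = Φ V at hf
        rw [← hf, ← ENNReal.toReal_natCast]
        exact ENNReal.toReal_mono (hfin V f) h2
      have h1' : (mistakes (fun _ => majority V f) S : ℝ) ≤ mistakes (fun _ => h) S +
          ((∑ t, if majority V f (S t).1 ≠ h (S t).1 then 1 else 0 : ℕ) : ℝ) := by
        exact_mod_cast h1
      linarith)
  rw [integral_add (integrable_const _) hΦint] at hmain
  simp only [integral_const, probReal_univ, smul_eq_mul, one_mul, Fintype.card_pi,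
    Fintype.card_fin, Finset.prod_const, Finset.card_univ, Nat.cast_pow, Real.log_pow] at hmain
  unfold expectedRegret
  rw [integral_sub (integrable_mistakes A S) (integrable_const _), ← hmin]
  simp only [integral_const, probReal_univ, smul_eq_mul, one_mul]
  linarith

/-! ### Conclusion: choice of the class size and absorption of constants -/

theorem mainTheorem6 :
    ∃ C : ℝ, 0 < C ∧
      ∀ (X : Type u) (H : Set (Hypothesis X)), H.Nonempty → repDim H < ∞ →
        ∀ ε : ℝ, 0 < ε → ∀ T : ℕ, 3 ≤ T →
          ∃ A : OnlineLearner X T, A.IsDP ε ∧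
            ∀ S : DataStream X T,
              expectedRegret A H S ≤
                C * (Real.sqrt T * Real.log T *
                  ((repDim H).toReal + Real.log (Real.log T)) / min ε 1) := by
  refine ⟨40000, by norm_num, fun X H hH hdim ε hε T hT => ?_⟩
  -- A near-minimizer of the infimum is enough; the slack `1` is absorbed by `log (log T)`.
  obtain ⟨k, ⟨hk, P, hPprob, hP⟩, hkdim⟩ : ∃ k : ℕ, (1 ≤ k ∧
      ∃ P : Measure (Fin k → Hypothesis X), IsProbabilityMeasure P ∧
        IsProbRep (1 / 4) (1 / 4) H P) ∧ ENNReal.ofReal (Real.log k) < repDim H + 1 := by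
    have h1 : repDim H < repDim H + 1 := ENNReal.lt_add_right hdim.ne one_ne_zero
    conv_lhs at h1 => rw [repDim]
    obtain ⟨k, hk⟩ := iInf_lt_iff.1 h1
    obtain ⟨hk', hlt⟩ := iInf_lt_iff.1 hk
    exact ⟨k, hk', hlt⟩
  have hlogk : Real.log k ≤ (repDim H).toReal + 1 := by
    have h2 := (ENNReal.ofReal_le_iff_le_toReal (by finiteness)).1 hkdim.le
    rwa [ENNReal.toReal_add hdim.ne ENNReal.one_ne_top, ENNReal.toReal_one] at h2
  obtain ⟨A, hA, hreg⟩ := exists_private_learner hH hk P hP hε (by omega : 1 ≤ T)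
    ⌈128 * Real.log T⌉₊ (Nat.le_ceil _)
  refine ⟨A, hA, fun S => (hreg S).trans ?_⟩
  have hT' : (3 : ℝ) ≤ T := by exact_mod_cast hT
  have hlogT : 1.09 ≤ Real.log T := by
    have h3 := Real.log_le_log (by norm_num) hT'
    have h4 : 1.09 ≤ Real.log 3 := by
      rw [Real.le_log_iff_exp_le (by norm_num)]
      have h5 : Real.exp 1.09 ^ 100 ≤ (3 : ℝ) ^ 100 := by
        rw [← Real.exp_nat_mul]
        have h6 : ((100 : ℕ) : ℝ) * 1.09 = (109 : ℕ) * 1 := by norm_num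
        rw [h6, Real.exp_nat_mul]
        calc Real.exp 1 ^ 109 ≤ 2.7182818286 ^ 109 := by
              gcongr
              exact Real.exp_one_lt_d9.le
          _ ≤ _ := by norm_num
      exact le_of_pow_le_pow_left₀ (by norm_num) (by norm_num) h5
    linarith
  -- For `T ≥ 3` this is bounded away from zero, so `R + 1 ≤ 13 * D`. The final constant must exceed
  -- `20 * 1677 + 2 * 13 + 13`.
  have hloglog : 1 / 13 ≤ Real.log (Real.log T) := by
    have h3 := Real.log_le_log (by norm_num) hlogT
    have h4 := Real.one_sub_inv_le_log_of_pos (by norm_num : (0 : ℝ) < 1.09)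
    norm_num at h3 h4 ⊢
    linarith
  set R := (repDim H).toReal with hR
  set l := Real.log T with hl
  set D := R + Real.log l with hD
  set s := Real.sqrt T with hs
  set e := min ε 1 with he
  have he₀ : 0 < e := lt_min hε one_pos
  have he₁ : e ≤ 1 := min_le_right _ _
  have hR₀ : 0 ≤ R := ENNReal.toReal_nonneg
  have hD₁ : R + 1 ≤ 13 * D := by linarith
  have hs₁ : 1 ≤ s := Real.one_le_sqrt.2 (by linarith)
  have hceil : (⌈128 * l⌉₊ : ℝ) ≤ 129 * l := by
    have := (Nat.ceil_lt_add_one (by positivity : 0 ≤ 128 * l)).le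
    linarith
  have hnk : (⌈128 * l⌉₊ : ℝ) * Real.log k ≤ 129 * l * (13 * D) :=
    mul_le_mul hceil (hlogk.trans hD₁) (Real.log_natCast_nonneg k) (by linarith)
  have hlD : 1 ≤ 13 * (l * D) := by nlinarith
  have h1 : s * (⌈128 * l⌉₊ * Real.log k) / e ≤ s * (129 * l * (13 * D)) / e := by gcongr
  have h2 : s ≤ 13 * (s * l * D / e) := by
    have : s ≤ s * (13 * (l * D)) := le_mul_of_one_le_right (by linarith) hlD
    calc s ≤ s * (13 * (l * D)) := this
      _ ≤ s * (13 * (l * D)) / e := le_div_self (by linarith) he₀ he₁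
      _ = _ := by ring
  have h3 : s * (129 * l * (13 * D)) / e = 1677 * (s * l * D / e) := by ring
  rw [h3] at h1
  linarith
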